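/- Let $n\ge 0$ be an integer and let $\mathbb R^n$ carry the Euclidean norm $\|\cdot\|$ and inner product $\langle\cdot,\cdot\rangle$. For $e\in\mathbb R^n\setminus\{0\}$ and $\alpha\in(0,1]$ let $$C_{e,\alpha}=\{x\in\mathbb R^n:\langle x,e\rangle\ge\alpha\|x\|\|e\|\},$$ and let $\Gamma_{e,\alpha}$ be the set of Lipschitz curves $\gamma:\mathbb R\to\mathbb R^n$ such that $\gamma'(t)\in C_{e,\alpha}$ for almost every $t\in\mathbb R$. The $(e,\alpha)$-width of an open set $G\subset\mathbb R^n$ is $$w_{e,\alpha}(G)=\sup\{\mathcal H^1(G\cap\gamma(\mathbb R)):\gamma\in\Gamma_{e,\alpha}\},$$ where $\mathcal H^1$ is the one-dimensional Hausdorff measure, and the $(e,\alpha)$-width of an arbitrary set $A\subset\mathbb R^n$ is $$w_{e,\alpha}(A)=\inf\{w_{e,\alpha}(G):G\supset A,\ G\text{ open}\}.$$ If $e=0$ or $\alpha>1$, put $w_{e,\alpha}(A)=0$ for every $A\subset\mathbb R^n$. For $E\subset\mathbb R^n$ and $x\in E$ let $$\mathcal N(E,x)=\{e\in\mathbb R^n:\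 \text{for every }\varepsilon>0\text{ there is }r>0\text{ with }w_{e,\varepsilon}(B(x,r)\cap E)=0\},$$ where $B(x,r)$ is the open ball with centre $x$ and radius $r$. The set $E$ is called cone unrectifiable if $\mathcal N(E,x)\ne\{0\}$ for every $x\in E$. Theorem. If $E\subset\mathbb R^n$ is cone unrectifiable, then there is a Lipschitz function $f:\mathbb R^n\to\mathbb R$ that is non-differentiable at every point of $E$. -/

import Mathlib

open Set MeasureTheory
open scoped ENNReal NNReal

noncomputable section

namespace ConeUnrectifiable

variable {n : ℕ}

/-- The closed cone `C_{e,α} = {x : ⟨x, e⟩ ≥ α ‖x‖ ‖e‖}`. -/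
def cone (e : EuclideanSpace ℝ (Fin n)) (α : ℝ) : Set (EuclideanSpace ℝ (Fin n)) :=
  {x | α * ‖x‖ * ‖e‖ ≤ inner ℝ x e}

/-- The set `Γ_{e,α}` of Lipschitz curves `γ : ℝ → ℝⁿ` with `γ'(t) ∈ C_{e,α}` for almost
every `t`.  (A Lipschitz curve is differentiable almost everywhere, so the value that `deriv`
takes where `γ` is not differentiable plays no role.) -/
def curves (e : EuclideanSpace ℝ (Fin n)) (α : ℝ) : Set (ℝ → EuclideanSpace ℝ (Fin n)) :=
  {γ | (∃ K : ℝ≥0, LipschitzWith K γ) ∧ ∀ᵐ t : ℝ, deriv γ t ∈ cone e α}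

/-- The supremum of `ℋ¹(G ∩ γ(ℝ))` over `γ ∈ Γ_{e,α}`: the `(e,α)`-width of an open set `G`. -/
def openWidth (e : EuclideanSpace ℝ (Fin n)) (α : ℝ) (G : Set (EuclideanSpace ℝ (Fin n))) :
    ℝ≥0∞ :=
  ⨆ γ ∈ curves e α, μH[1] (G ∩ range γ)

open Classical in
/-- The `(e,α)`-width of an arbitrary set: the infimum of the widths of the open sets that
contain it.  By convention it is `0` when `e = 0` or `α > 1`. -/
def width (e : EuclideanSpace ℝ (Fin n)) (α : ℝ) (E : Set (EuclideanSpace ℝ (Fin n))) : ℝ≥0∞ :=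
  if e = 0 ∨ 1 < α then 0
  else ⨅ (G : Set (EuclideanSpace ℝ (Fin n))) (_ : IsOpen G ∧ E ⊆ G), openWidth e α G

/-- The set `𝒩(E, x)` of all `e` such that for every `ε > 0` some neighbourhood of `x` in `E`
has `(e,ε)`-width zero. -/
def normals (E : Set (EuclideanSpace ℝ (Fin n))) (x : EuclideanSpace ℝ (Fin n)) :
    Set (EuclideanSpace ℝ (Fin n)) :=
  {e | ∀ ε : ℝ, 0 < ε → ∃ r : ℝ, 0 < r ∧ width e ε (Metric.ball x r ∩ E) = 0}

/-- `E` is cone unrectifiable if `𝒩(E, x) ≠ {0}` for every `x ∈ E`. -/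
def IsConeUnrectifiable (E : Set (EuclideanSpace ℝ (Fin n))) : Prop :=
  ∀ x ∈ E, normals E x ≠ {0}

end ConeUnrectifiable

end

open Filter Topology

namespace ConeUnrectifiable

variable {n : ℕ}

/-! An open set `H` of small width in direction `e` carries a tiny function with gradient close to
`v = e / ‖e‖` inside `H`. It is obtained by measuring how much of `H` a curve in the cone can
collect before reaching `x`, then regularising across `v` (`exists_width_function`). A set of width
zero lies in such sets `H` for every bound. Gluing the resulting functions with a partition of unity
gives functions as small as desired, even compared with a given scale function `D`, whose gradient
on the set is nearly `v` (`NullWidth.exists_function`).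

A cone unrectifiable set is covered by countably many balls, each with its own unit direction `v i`.
Averaging the `v i` could produce cancellation, so one averages the matrices `v i ⊗ v i` instead,
whose trace is always one. Their rows are `n` vector fields, each almost the gradient near `E` of
arbitrarily small functions, and at every point of `E` one of them has norm at least `1 / n`
(`exists_smallGradient_fields`).

For each field in turn, choose two functions `g s`, `h s` with this almost-gradient, where `h s`
lives on a far smaller scale than `g s`. Below both scales `g s - h s` is nearly flat, so the slopes
of successive differences do not accumulate and the sum of all differences is Lipschitz
(`eventually_partialSum`, `limit_lipschitz`). At a point of `E` the sum looks flat on the scale just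
after a pair is completed. Between the two functions of a pair it looks affine with gradient `u s
x`, which is not small for infinitely many `s`. No derivative can match both
(`not_differentiableAt_limit`). -/

/-- The sublinear function `w ↦ max 0 (⟨v, w⟩ + β ‖w - ⟨v, w⟩ v‖)`. -/
noncomputable def coneGauge (v : EuclideanSpace ℝ (Fin n)) (β : ℝ) (w : EuclideanSpace ℝ (Fin n)) :
    ℝ :=
  max 0 (inner ℝ v w + β * ‖w - inner ℝ v w • v‖)

/-! ### The asymmetric gauge of a round cone. -/

section coneGauge

variable {v : EuclideanSpace ℝ (Fin n)} {β : ℝ}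

lemma coneGauge_nonneg (w : EuclideanSpace ℝ (Fin n)) : 0 ≤ coneGauge v β w := le_max_left _ _

@[simp] lemma coneGauge_zero : coneGauge v β 0 = 0 := by simp [coneGauge]

lemma coneGauge_add_le (hβ : 0 ≤ β) (x y : EuclideanSpace ℝ (Fin n)) :
    coneGauge v β (x + y) ≤ coneGauge v β x + coneGauge v β y := by
  have h : x + y - inner ℝ v (x + y) • v
      = (x - inner ℝ v x • v) + (y - inner ℝ v y • v) := by
    rw [inner_add_right]; module
  have h1 := mul_le_mul_of_nonneg_left
    (norm_add_le (x - inner ℝ v x • v) (y - inner ℝ v y • v)) hβ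
  rw [← h] at h1
  refine max_le (add_nonneg (coneGauge_nonneg x) (coneGauge_nonneg y)) ?_
  have h2 : _ ≤ coneGauge v β x := le_max_right _ _
  have h3 : _ ≤ coneGauge v β y := le_max_right _ _
  rw [inner_add_right] at h1 ⊢
  linarith

lemma norm_sub_inner_smul_le (hv : ‖v‖ = 1) (w : EuclideanSpace ℝ (Fin n)) :
    ‖w - inner ℝ v w • v‖ ≤ ‖w‖ := by
  have h : ‖w - inner ℝ v w • v‖ ^ 2 = ‖w‖ ^ 2 - (inner ℝ v w) ^ 2 := by
    rw [norm_sub_sq_real, norm_smul, inner_smul_right, real_inner_comm, hv, Real.norm_eq_abs,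
      mul_one, sq_abs]
    ring
  refine abs_le_of_sq_le_sq' (by nlinarith [sq_nonneg (inner ℝ v w)]) (norm_nonneg _) |>.2

lemma sub_smul_perp (hv : ‖v‖ = 1) (w : EuclideanSpace ℝ (Fin n)) (t : ℝ) :
    (w - t • v) - inner ℝ v (w - t • v) • v = w - inner ℝ v w • v := by
  rw [inner_sub_right, inner_smul_right, real_inner_self_eq_norm_sq, hv]
  module

/-- Consequently `coneGauge v β w` is the least `t ≥ 0` for which `t • v - w` lies in the cone `β ‖d
- ⟨v, d⟩ v‖ ≤ ⟨v, d⟩`: it measures how far to move along `v` to get above `w`. -/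
lemma coneGauge_sub_smul (hv : ‖v‖ = 1) (w : EuclideanSpace ℝ (Fin n)) (t : ℝ) :
    coneGauge v β (w - t • v) = max 0 (inner ℝ v w + β * ‖w - inner ℝ v w • v‖ - t) := by
  rw [coneGauge, sub_smul_perp hv, inner_sub_right, inner_smul_right, real_inner_self_eq_norm_sq,
    hv]
  ring_nf

lemma coneGauge_le (hβ : 0 ≤ β) (hv : ‖v‖ = 1) (w : EuclideanSpace ℝ (Fin n)) :
    coneGauge v β w ≤ (1 + β) * ‖w‖ := by
  have h1 : inner ℝ v w ≤ ‖w‖ := by simpa [hv] using real_inner_le_norm v w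
  have h2 := mul_le_mul_of_nonneg_left (norm_sub_inner_smul_le hv w) hβ
  exact max_le (by positivity) (by linarith)

/-- Splitting `d` along `v` gives `‖d‖ ≤ ⟨v, d⟩ + ‖d - ⟨v, d⟩ v‖ ≤ (1 + 1/β) ⟨v, d⟩`, which is where
the opening `β / (1 + β)` comes from. -/
lemma mem_cone_of_le (hβ : 0 < β) {e d : EuclideanSpace ℝ (Fin n)} (he : e ≠ 0)
    (hve : v = ‖e‖⁻¹ • e)
    (hd : β * ‖d - inner ℝ v d • v‖ ≤ inner ℝ v d) : d ∈ cone e (β / (1 + β)) := by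
  have he' : 0 < ‖e‖ := norm_pos_iff.2 he
  have hv : ‖v‖ = 1 := by
    rw [hve, norm_smul, norm_inv, norm_norm, inv_mul_cancel₀ he'.ne']
  have hev : e = ‖e‖ • v := by rw [hve, smul_smul, mul_inv_cancel₀ he'.ne', one_smul]
  have h0 : 0 ≤ inner ℝ v d := le_trans (by positivity) hd
  have h1 : ‖d‖ ≤ inner ℝ v d + ‖d - inner ℝ v d • v‖ := by
    calc ‖d‖ = ‖inner ℝ v d • v + (d - inner ℝ v d • v)‖ := by congr 1; abel
      _ ≤ _ := norm_add_le _ _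
      _ = _ := by rw [norm_smul, hv, Real.norm_of_nonneg h0, mul_one]
  have h2 : (inner ℝ d e : ℝ) = ‖e‖ * inner ℝ v d := by
    conv_lhs => rw [hev]
    rw [inner_smul_right, real_inner_comm]
  show β / (1 + β) * ‖d‖ * ‖e‖ ≤ inner ℝ d e
  rw [h2, mul_comm]
  refine mul_le_mul_of_nonneg_left ?_ he'.le
  rw [div_mul_eq_mul_div, div_le_iff₀ (by positivity)]
  nlinarith

end coneGauge

/-! ### Curves in a cone and the length they collect inside a set. -/

/-- The curve that follows `γ` until time `T` and the direction `d` afterwards. -/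
noncomputable def continueCurve (γ : ℝ → EuclideanSpace ℝ (Fin n)) (T : ℝ)
    (d : EuclideanSpace ℝ (Fin n)) (t : ℝ) : EuclideanSpace ℝ (Fin n) :=
  γ (min t T) + max (t - T) 0 • d

lemma continueCurve_of_le {γ : ℝ → EuclideanSpace ℝ (Fin n)} {T t : ℝ}
    {d : EuclideanSpace ℝ (Fin n)} (h : t ≤ T) : continueCurve γ T d t = γ t := by
  simp [continueCurve, h]

lemma continueCurve_of_ge {γ : ℝ → EuclideanSpace ℝ (Fin n)} {T t : ℝ}
    {d : EuclideanSpace ℝ (Fin n)} (h : T ≤ t) :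
    continueCurve γ T d t = γ T + (t - T) • d := by
  simp [continueCurve, h]

lemma continueCurve_mem_curves {e : EuclideanSpace ℝ (Fin n)} {α : ℝ}
    {γ : ℝ → EuclideanSpace ℝ (Fin n)} (hγ : γ ∈ curves e α) (T : ℝ)
    {d : EuclideanSpace ℝ (Fin n)} (hd : d ∈ cone e α) : continueCurve γ T d ∈ curves e α := by
  obtain ⟨⟨K, hK⟩, hae⟩ := hγ
  refine ⟨⟨K * 1 + ‖d‖₊ * 1, ?_⟩, ?_⟩
  · refine LipschitzWith.add (hK.comp (LipschitzWith.id.min_const T)) ?_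
    refine LipschitzWith.of_dist_le_mul fun s t => ?_
    rw [dist_eq_norm, ← sub_smul, norm_smul, mul_comm]
    have h := abs_max_sub_max_le_abs (s - T) (t - T) 0
    rw [sub_sub_sub_cancel_right] at h
    simpa [Real.dist_eq] using mul_le_mul_of_nonneg_left h (norm_nonneg d)
  · have hT : ∀ᵐ t : ℝ, t ≠ T := by simp [ae_iff]
    filter_upwards [hae, hT] with t ht htT
    rcases lt_or_gt_of_ne htT with h | h
    · have : continueCurve γ T d =ᶠ[nhds t] γ := by
        filter_upwards [Iio_mem_nhds h] with s hs using continueCurve_of_le (le_of_lt hs)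
      rwa [this.deriv_eq]
    · have : continueCurve γ T d =ᶠ[nhds t] fun s => γ T + (s - T) • d := by
        filter_upwards [Ioi_mem_nhds h] with s hs using continueCurve_of_ge (le_of_lt hs)
      rw [this.deriv_eq]
      have hder : HasDerivAt (fun s : ℝ => γ T + (s - T) • d) ((1 : ℝ) • d) t :=
        (((hasDerivAt_id t).sub_const T).smul_const d).const_add (γ T)
      rwa [hder.deriv, one_smul]

/-- The largest measure in `H` of the part up to `x` of a curve in `Γ_{e,α}` through `x`. -/
noncomputable def reach (e v : EuclideanSpace ℝ (Fin n)) (α : ℝ) (H : Set (EuclideanSpace ℝ (Fin n)))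
    (x : EuclideanSpace ℝ (Fin n)) : ℝ≥0∞ :=
  ⨆ (γ : ℝ → EuclideanSpace ℝ (Fin n)) (T : ℝ) (_ : γ ∈ curves e α ∧ γ T = x),
    μH[1] (H ∩ γ '' Iic T ∩ {z | inner ℝ v z ≤ inner ℝ v x})

section reach

variable {e v : EuclideanSpace ℝ (Fin n)} {α : ℝ} {H : Set (EuclideanSpace ℝ (Fin n))}

lemma reach_le_openWidth (x : EuclideanSpace ℝ (Fin n)) : reach e v α H x ≤ openWidth e α H := by
  refine iSup_le fun γ => iSup_le fun T => iSup_le fun h => ?_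
  refine le_trans (measure_mono ?_) (le_iSup₂ (f := fun γ (_ : γ ∈ curves e α) =>
    μH[1] (H ∩ range γ)) γ h.1)
  exact inter_subset_left.trans (inter_subset_inter_right _ (image_subset_range _ _))

lemma reach_mono {y d : EuclideanSpace ℝ (Fin n)} (hd : d ∈ cone e α) (hvd : 0 ≤ inner ℝ v d) :
    reach e v α H y ≤ reach e v α H (y + d) := by
  refine iSup_le fun γ => iSup_le fun T => iSup_le fun h => ?_
  refine le_trans (measure_mono ?_) (le_iSup_of_le (continueCurve γ T d) <|
    le_iSup_of_le (T + 1) <| le_iSup_of_le ⟨continueCurve_mem_curves h.1 T hd, ?_⟩ le_rfl)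
  · rintro z ⟨⟨hzH, t, ht, rfl⟩, hz⟩
    refine ⟨⟨hzH, t, ?_, continueCurve_of_le ht⟩, ?_⟩
    · simp only [mem_Iic] at ht ⊢; linarith
    · simp only [mem_ofPred_eq, inner_add_right] at hz ⊢; linarith
  · rw [continueCurve_of_ge (by linarith), h.2]; simp

lemma line_mem_curves (y : EuclideanSpace ℝ (Fin n)) (hve : v ∈ cone e α) :
    (fun s : ℝ => y + s • v) ∈ curves e α := by
  refine ⟨⟨‖v‖₊, LipschitzWith.of_dist_le_mul fun s t => ?_⟩, ?_⟩
  · rw [dist_add_left, dist_eq_norm, ← sub_smul, norm_smul, mul_comm]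
    simp [Real.dist_eq]
  · refine Filter.Eventually.of_forall fun t => ?_
    have : HasDerivAt (fun s : ℝ => y + s • v) ((1 : ℝ) • v) t :=
      ((hasDerivAt_id t).smul_const v).const_add y
    rwa [this.deriv, one_smul]

lemma smul_mem_cone (hve : v ∈ cone e α) {t : ℝ} (ht : 0 ≤ t) : t • v ∈ cone e α := by
  simp only [cone, mem_ofPred_eq] at hve ⊢
  rw [norm_smul, inner_smul_left, Real.norm_of_nonneg ht]
  have := mul_le_mul_of_nonneg_left hve ht
  simp only [conj_trivial]
  linarith

/-- Appending the segment to a competing curve collects extra length `t`. The half-space cut in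
`reach` makes the segment disjoint from what was already counted, without proving that the curve is
monotone in direction `v`. -/
lemma reach_add_le (hv : ‖v‖ = 1) (hve : v ∈ cone e α)
    {y : EuclideanSpace ℝ (Fin n)} {t : ℝ} (ht : 0 ≤ t) (hH : segment ℝ y (y + t • v) ⊆ H) :
    reach e v α H y + ENNReal.ofReal t ≤ reach e v α H (y + t • v) := by
  have htv := smul_mem_cone hve ht
  have hvt : ∀ s : ℝ, inner ℝ v (y + s • v) = inner ℝ v y + s := fun s => by
    rw [inner_add_right, inner_smul_right, real_inner_self_eq_norm_sq, hv]; norm_num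
  have key : ∀ (γ : ℝ → EuclideanSpace ℝ (Fin n)) (T : ℝ), γ ∈ curves e α ∧ γ T = y →
      μH[1] (H ∩ γ '' Iic T ∩ {z | inner ℝ v z ≤ inner ℝ v y}) + ENNReal.ofReal t
        ≤ reach e v α H (y + t • v) := by
    intro γ T h
    set S : Set (EuclideanSpace ℝ (Fin n)) := segment ℝ y (y + t • v) \ {y} with hS
    have hSm : MeasurableSet S := by
      refine MeasurableSet.diff (IsCompact.measurableSet ?_) (measurableSet_singleton y)
      rw [segment_eq_image_lineMap]
      exact isCompact_Icc.image AffineMap.lineMap_continuous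
    have hSmem : ∀ z ∈ S, ∃ s : ℝ, 0 < s ∧ s ≤ t ∧ z = y + s • v := by
      rintro z ⟨hz, hzy⟩
      rw [segment_eq_image', mem_image] at hz
      obtain ⟨θ, hθ, rfl⟩ := hz
      have h0 : 0 ≤ θ * t := mul_nonneg hθ.1 ht
      refine ⟨θ * t, lt_of_le_of_ne h0 fun h0 => hzy ?_, mul_le_of_le_one_left ht hθ.2, ?_⟩
      · simp [smul_smul, ← h0]
      · simp [smul_smul]
    have hSt : ENNReal.ofReal t ≤ μH[1] S := by
      have h1 : μH[1] (segment ℝ y (y + t • v)) = ENNReal.ofReal t := by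
        rw [hausdorffMeasure_segment, edist_dist, dist_self_add_right, norm_smul, hv,
          Real.norm_of_nonneg ht, mul_one]
      have h2 : μH[1] ({y} : Set (EuclideanSpace ℝ (Fin n))) = 0 := by
        have := Measure.nullSingletonClass_hausdorff (EuclideanSpace ℝ (Fin n)) (d := 1) one_pos
        exact measure_singleton y
      rw [hS, measure_sdiff_null h2, h1]
    refine le_trans (add_le_add_right hSt _) ?_
    rw [← measure_union ?_ hSm]
    · refine le_trans (measure_mono ?_) (le_iSup_of_le (continueCurve γ T (t • v)) <|
        le_iSup_of_le (T + 1) <| le_iSup_of_le ⟨continueCurve_mem_curves h.1 T htv, ?_⟩ le_rfl)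
      · refine union_subset ?_ ?_
        · rintro z ⟨⟨hzH, s, hs, rfl⟩, hz⟩
          refine ⟨⟨hzH, s, ?_, continueCurve_of_le hs⟩, ?_⟩
          · simp only [mem_Iic] at hs ⊢; linarith
          · simp only [mem_ofPred_eq] at hz ⊢; rw [hvt]; linarith
        · intro z hz
          refine ⟨⟨hH hz.1, ?_⟩, ?_⟩
          · obtain ⟨s, hs0, hst, rfl⟩ := hSmem z hz
            have ht0 : 0 < t := hs0.trans_le hst
            have hst' : s / t ≤ 1 := (div_le_one ht0).2 hst
            have hst0 : 0 ≤ s / t := by positivity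
            refine ⟨T + s / t, by simp only [mem_Iic]; linarith, ?_⟩
            rw [continueCurve_of_ge (by linarith), h.2, smul_smul]
            congr 2
            field_simp
            ring
          · obtain ⟨s, hs0, hst, rfl⟩ := hSmem z hz
            simp only [mem_ofPred_eq]
            rw [hvt, hvt]; linarith
      · rw [continueCurve_of_ge (by linarith), h.2]; simp
    · rw [Set.disjoint_left]
      rintro z ⟨_, hz⟩ hzS
      obtain ⟨s, hs0, hst, rfl⟩ := hSmem z hzS
      simp only [mem_ofPred_eq] at hz
      rw [hvt] at hz; linarith
  -- A straight line already collects `t`; this lets the truncated subtraction below be undone.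
  have hle : ENNReal.ofReal t ≤ reach e v α H (y + t • v) :=
    le_trans le_add_self (key _ 0 ⟨line_mem_curves y hve, by simp⟩)
  rw [← tsub_add_cancel_of_le hle]
  gcongr
  exact iSup_le fun γ => iSup_le fun T => iSup_le fun h =>
    ENNReal.le_sub_of_add_le_right ENNReal.ofReal_ne_top (key γ T h)

end reach

/-! ### Small functions with prescribed gradient on open sets of small width. -/

/-- An open set of small width carries a small function that increases at unit speed in the
direction `v` inside the set and has small slope in the directions orthogonal to `v`. -/
lemma exists_width_function {e v : EuclideanSpace ℝ (Fin n)} (he : e ≠ 0) (hve : v = ‖e‖⁻¹ • e)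
    {β ε : ℝ} (hβ : 0 < β) (hε : 0 ≤ ε) {H : Set (EuclideanSpace ℝ (Fin n))}
    (hw : openWidth e (β / (1 + β)) H ≤ ENNReal.ofReal ε) :
    ∃ h : EuclideanSpace ℝ (Fin n) → ℝ, (∀ x, 0 ≤ h x ∧ h x ≤ ε) ∧
      (∀ x w, h (x + w) - h x ≤ coneGauge v β w) ∧
      ∀ x t, 0 ≤ t → segment ℝ x (x + t • v) ⊆ H → h x + t ≤ h (x + t • v) := by
  have he' : 0 < ‖e‖ := norm_pos_iff.2 he
  have hv : ‖v‖ = 1 := by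
    rw [hve, norm_smul, norm_inv, norm_norm, inv_mul_cancel₀ he'.ne']
  have hvv : inner ℝ v v = (1 : ℝ) := by rw [real_inner_self_eq_norm_sq, hv]; norm_num
  have hvc : v ∈ cone e (β / (1 + β)) := mem_cone_of_le hβ he hve (by rw [hvv]; simp)
  set R := reach e v (β / (1 + β)) H
  have hRε : ∀ x, R x ≤ ENNReal.ofReal ε := fun x => (reach_le_openWidth x).trans hw
  have hRtop : ∀ x, R x ≠ ⊤ := fun x => ne_top_of_le_ne_top ENNReal.ofReal_ne_top (hRε x)
  set r : EuclideanSpace ℝ (Fin n) → ℝ := fun x => (R x).toReal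
  have hr0 : ∀ x, 0 ≤ r x := fun x => ENNReal.toReal_nonneg
  have hrε : ∀ x, r x ≤ ε := fun x => ENNReal.toReal_le_of_le_ofReal hε (hRε x)
  have hrmono : ∀ y d, β * ‖d - inner ℝ v d • v‖ ≤ inner ℝ v d → r y ≤ r (y + d) :=
    fun y d hd => ENNReal.toReal_mono (hRtop _)
      (reach_mono (mem_cone_of_le hβ he hve hd) (le_trans (by positivity) hd))
  have hradd : ∀ y t, 0 ≤ t → segment ℝ y (y + t • v) ⊆ H → r y + t ≤ r (y + t • v) := by
    intro y t ht hH
    have := ENNReal.toReal_mono (hRtop _) (reach_add_le hv hvc ht hH)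
    rwa [ENNReal.toReal_add (hRtop _) ENNReal.ofReal_ne_top, ENNReal.toReal_ofReal ht] at this
  -- `r` may jump across `v`; this sup-convolution with the gauge bounds the slopes and keeps both
  -- the bound by `ε` and the unit growth along `v`.
  set h : EuclideanSpace ℝ (Fin n) → ℝ := fun x => ⨆ y, r y - coneGauge v β (y - x) with hh
  have hbdd : ∀ x, BddAbove (range fun y => r y - coneGauge v β (y - x)) := by
    refine fun x => ⟨ε, ?_⟩
    rintro _ ⟨y, rfl⟩
    have := hrε y; have := coneGauge_nonneg (v := v) (β := β) (y - x)
    show r y - coneGauge v β (y - x) ≤ ε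
    linarith
  have hle : ∀ x y, r y - coneGauge v β (y - x) ≤ h x := fun x y => le_ciSup (hbdd x) y
  have hrh : ∀ x, r x ≤ h x := fun x => by simpa using hle x x
  refine ⟨h, fun x => ⟨(hr0 x).trans (hrh x), ciSup_le fun y => ?_⟩, fun x w => ?_,
    fun x t ht hH => ?_⟩
  · have := hrε y; have := coneGauge_nonneg (v := v) (β := β) (y - x); linarith
  · rw [sub_le_iff_le_add]
    refine ciSup_le fun y => ?_
    have h1 := hle x y
    have h2 := coneGauge_add_le (v := v) hβ.le (y - (x + w)) w
    rw [show y - (x + w) + w = y - x by abel] at h2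
    linarith
  · rw [← le_sub_iff_add_le]
    refine ciSup_le fun y => ?_
    set A := inner ℝ v (y - x) + β * ‖(y - x) - inner ℝ v (y - x) • v‖ with hA
    have hg : coneGauge v β (y - x) = max 0 A := rfl
    -- If `y` is at gauge distance at least `t`, moving the base point by `t • v` saves `t` in the
    -- gauge. Otherwise a move by `t' < t` already gets above `y` in the cone order, and the
    -- remaining `t - t'` is gained by `r` along the segment.
    rcases le_or_gt t (coneGauge v β (y - x)) with hc | hc
    · have h1 := hle (x + t • v) y
      rw [← sub_sub, coneGauge_sub_smul hv, ← hA] at h1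
      have h2 : max 0 (A - t) ≤ coneGauge v β (y - x) - t :=
        max_le (by linarith) (by rw [hg]; linarith [le_max_right 0 A])
      linarith
    · set t' := coneGauge v β (y - x) with ht'
      have ht0 : 0 ≤ t' := coneGauge_nonneg _
      have hAt : A ≤ t' := le_max_right _ _
      have h1 : r y ≤ r (x + t' • v) := by
        have h2 : y + -(y - x - t' • v) = x + t' • v := by abel
        rw [← h2]
        refine hrmono _ _ ?_
        have h3 : -(y - x - t' • v) - inner ℝ v (-(y - x - t' • v)) • v
            = -((y - x - t' • v) - inner ℝ v (y - x - t' • v) • v) := by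
          rw [inner_neg_right]; module
        rw [h3, norm_neg, sub_smul_perp hv, inner_neg_right, inner_sub_right _ (y - x), inner_smul_right,
          hvv]
        linarith
      have h2 : r (x + t' • v) + (t - t') ≤ r (x + t' • v + (t - t') • v) := by
        refine hradd _ _ (by linarith) (subset_trans ?_ hH)
        have h3 : x + t' • v + (t - t') • v = x + t • v := by module
        rw [h3]
        refine (convex_segment _ _).segment_subset ?_ (right_mem_segment _ _ _)
        rw [segment_eq_image', mem_image]
        refine ⟨t' / t, ⟨by positivity, (div_le_one (by linarith)).2 hc.le⟩, ?_⟩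
        rw [add_sub_cancel_left, smul_smul, div_mul_cancel₀ _ (by linarith)]
      have h3 : x + t' • v + (t - t') • v = x + t • v := by module
      rw [h3] at h2
      have h4 := hrh (x + t • v)
      linarith

/-- Away from the boundary of an open set `H` of small width, the function of the previous lemma is
uniformly close to being affine with gradient `v`. -/
lemma exists_lipschitz_width_function {e v : EuclideanSpace ℝ (Fin n)} (he : e ≠ 0)
    (hve : v = ‖e‖⁻¹ • e)
    {β ε : ℝ} (hβ : 0 < β) (hε : 0 ≤ ε) {H : Set (EuclideanSpace ℝ (Fin n))}
    (hw : openWidth e (β / (1 + β)) H ≤ ENNReal.ofReal ε) :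
    ∃ h : EuclideanSpace ℝ (Fin n) → ℝ, (∀ x, |h x| ≤ ε) ∧
      (∀ z z', |h z - h z'| ≤ (1 + β) * ‖z - z'‖) ∧
      ∀ y r, Metric.ball y (3 * r) ⊆ H → ∀ z ∈ Metric.ball y r, ∀ z' ∈ Metric.ball y r,
        |h z - h z' - inner ℝ v (z - z')| ≤ β * ‖z - z'‖ := by
  obtain ⟨h, hb, hlip, hinc⟩ := exists_width_function he hve hβ hε hw
  have he' : 0 < ‖e‖ := norm_pos_iff.2 he
  have hv : ‖v‖ = 1 := by
    rw [hve, norm_smul, norm_inv, norm_norm, inv_mul_cancel₀ he'.ne']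
  have hvv : inner ℝ v v = (1 : ℝ) := by rw [real_inner_self_eq_norm_sq, hv]; norm_num
  have hlip' : ∀ z z', h z - h z' ≤ (1 + β) * ‖z - z'‖ := fun z z' => by
    have := hlip z' (z - z')
    rw [add_sub_cancel] at this
    exact this.trans (coneGauge_le hβ.le hv _)
  refine ⟨h, fun x => abs_le.2 ⟨by linarith [(hb x).1], (hb x).2⟩, fun z z' => abs_le.2
    ⟨by have := hlip' z' z; rw [norm_sub_rev] at this; linarith, hlip' z z'⟩, ?_⟩
  intro y r hH
  have key : ∀ z ∈ Metric.ball y r, ∀ z' ∈ Metric.ball y r, 0 ≤ inner ℝ v (z - z') →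
      |h z - h z' - inner ℝ v (z - z')| ≤ β * ‖z - z'‖ := by
    intro z hz z' hz' ht
    set t : ℝ := inner ℝ v (z - z') with htdef
    set p := (z - z') - t • v with hp
    have hpn : β * ‖p‖ ≤ β * ‖z - z'‖ :=
      mul_le_mul_of_nonneg_left (norm_sub_inner_smul_le hv _) hβ.le
    have htn : |t| ≤ ‖z - z'‖ := by simpa [hv] using abs_real_inner_le_norm v (z - z')
    have hpv : inner ℝ v p = (0 : ℝ) := by
      rw [hp, inner_sub_right, inner_smul_right, hvv]; simp [htdef]
    have h1 := hlip z' (z - z')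
    rw [add_sub_cancel] at h1
    have h2 : coneGauge v β (z - z') ≤ t + β * ‖p‖ := max_le (by positivity) le_rfl
    have h3 := hinc z' t ht (by
      refine subset_trans ((convex_ball y (3 * r)).segment_subset ?_ ?_) hH
      · rw [Metric.mem_ball, dist_eq_norm] at hz' ⊢
        linarith [norm_nonneg (z' - y)]
      · rw [Metric.mem_ball, dist_eq_norm] at hz hz' ⊢
        have h4 : ‖z' + t • v - y‖ ≤ ‖z' - y‖ + ‖t • v‖ := by
          rw [show z' + t • v - y = (z' - y) + t • v by abel]; exact norm_add_le _ _
        have h5 : ‖z - z'‖ ≤ ‖z - y‖ + ‖z' - y‖ := by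
          rw [show z - z' = (z - y) - (z' - y) by abel]; exact norm_sub_le _ _
        rw [norm_smul, hv, mul_one, Real.norm_eq_abs] at h4
        linarith)
    -- Lower bound: climb from `z'` to `z - p` along `v` inside `H`, then pay at most `β * ‖p‖` for
    -- the orthogonal correction.
    have h4 := hlip z (-p)
    have h5 : z + -p = z' + t • v := by rw [hp]; abel
    have h6 : coneGauge v β (-p) ≤ β * ‖p‖ := by
      refine max_le (by positivity) ?_
      rw [inner_neg_right, hpv]; simp
    rw [h5] at h4
    rw [abs_le]
    constructor <;> linarith
  intro z hz z' hz'
  rcases le_total 0 (inner ℝ v (z - z') : ℝ) with ht | ht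
  · exact key z hz z' hz' ht
  · have := key z' hz' z hz (by rw [← neg_sub, inner_neg_right]; linarith)
    rw [norm_sub_rev, ← abs_neg] at this
    convert this using 2
    rw [← neg_sub z z', inner_neg_right]; ring

/-! ### Mixing functions and gradients with a partition of unity. -/

/-- Weights of a partition of unity built from a sequence of functions with values in `[0,1]`. -/
noncomputable def weight (b : ℕ → EuclideanSpace ℝ (Fin n) → ℝ) (i : ℕ)
    (z : EuclideanSpace ℝ (Fin n)) : ℝ :=
  b i z * ∏ j ∈ Finset.range i, (1 - b j z)

section weight

variable {b : ℕ → EuclideanSpace ℝ (Fin n) → ℝ}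

lemma sum_weight (m : ℕ) (z : EuclideanSpace ℝ (Fin n)) :
    ∑ i ∈ Finset.range m, weight b i z = 1 - ∏ j ∈ Finset.range m, (1 - b j z) := by
  induction m with
  | zero => simp
  | succ m ih => rw [Finset.sum_range_succ, Finset.prod_range_succ, ih, weight]; ring

lemma prod_one_sub_mem (hb : ∀ i z, b i z ∈ Icc (0 : ℝ) 1) (m : ℕ)
    (z : EuclideanSpace ℝ (Fin n)) : ∏ j ∈ Finset.range m, (1 - b j z) ∈ Icc (0 : ℝ) 1 :=
  ⟨Finset.prod_nonneg fun j _ => by linarith [(hb j z).2],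
    Finset.prod_le_one (fun j _ => by linarith [(hb j z).2]) fun j _ => by linarith [(hb j z).1]⟩

lemma weight_nonneg (hb : ∀ i z, b i z ∈ Icc (0 : ℝ) 1) (i : ℕ) (z : EuclideanSpace ℝ (Fin n)) :
    0 ≤ weight b i z :=
  mul_nonneg (hb i z).1 (prod_one_sub_mem hb i z).1

lemma summable_weight (hb : ∀ i z, b i z ∈ Icc (0 : ℝ) 1) (z : EuclideanSpace ℝ (Fin n)) :
    Summable fun i => weight b i z :=
  summable_of_sum_range_le (c := 1) (fun i => weight_nonneg hb i z) fun m => by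
    rw [sum_weight]; linarith [(prod_one_sub_mem hb m z).1]

lemma tsum_weight_le (hb : ∀ i z, b i z ∈ Icc (0 : ℝ) 1) (z : EuclideanSpace ℝ (Fin n)) :
    ∑' i, weight b i z ≤ 1 :=
  Real.tsum_le_of_sum_range_le (fun i => weight_nonneg hb i z) fun m => by
    rw [sum_weight]; linarith [(prod_one_sub_mem hb m z).1]

lemma weight_eq_zero_of_lt {m i : ℕ} {z : EuclideanSpace ℝ (Fin n)} (hm : b m z = 1)
    (hi : m < i) : weight b i z = 0 := by
  rw [weight, Finset.prod_eq_zero (Finset.mem_range.2 hi) (by rw [hm, sub_self]), mul_zero]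

lemma sum_weight_eq_one {m : ℕ} {z : EuclideanSpace ℝ (Fin n)} (hm : b m z = 1) :
    ∑ i ∈ Finset.range (m + 1), weight b i z = 1 := by
  rw [sum_weight, Finset.prod_range_succ, hm]; simp

lemma abs_mul_sub_mul_le {a a' c c' K L d : ℝ} (ha : a ∈ Icc (0 : ℝ) 1) (hc : c' ∈ Icc (0 : ℝ) 1)
    (h1 : |a - a'| ≤ K * d) (h2 : |c - c'| ≤ L * d) : |a * c - a' * c'| ≤ (K + L) * d := by
  rw [show a * c - a' * c' = a * (c - c') + (a - a') * c' by ring]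
  refine (abs_add_le _ _).trans ?_
  rw [abs_mul, abs_mul, abs_of_nonneg ha.1, abs_of_nonneg hc.1]
  nlinarith [abs_nonneg (c - c'), abs_nonneg (a - a'), ha.1, ha.2, hc.1, hc.2]

lemma exists_lipschitz_weight (hb : ∀ i z, b i z ∈ Icc (0 : ℝ) 1)
    (hK : ∀ i, ∃ K : ℝ, ∀ z z', |b i z - b i z'| ≤ K * ‖z - z'‖) (i : ℕ) :
    ∃ K : ℝ, ∀ z z', |weight b i z - weight b i z'| ≤ K * ‖z - z'‖ := by
  have hP : ∃ K : ℝ, ∀ z z', |∏ j ∈ Finset.range i, (1 - b j z)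
      - ∏ j ∈ Finset.range i, (1 - b j z')| ≤ K * ‖z - z'‖ := by
    induction i with
    | zero => exact ⟨0, by simp⟩
    | succ m ih =>
      obtain ⟨K, hKm⟩ := ih
      obtain ⟨L, hL⟩ := hK m
      refine ⟨K + L, fun z z' => ?_⟩
      rw [Finset.prod_range_succ, Finset.prod_range_succ]
      refine abs_mul_sub_mul_le (prod_one_sub_mem hb m z)
        ⟨by linarith [(hb m z').2], by linarith [(hb m z').1]⟩ (hKm z z') ?_
      rw [sub_sub_sub_cancel_left, abs_sub_comm]
      exact hL z z'
  obtain ⟨K, hKi⟩ := hP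
  obtain ⟨L, hL⟩ := hK i
  exact ⟨L + K, fun z z' => abs_mul_sub_mul_le (hb i z) (prod_one_sub_mem hb i z') (hL z z')
    (hKi z z')⟩

/-- The combination of the functions `g i` with the weights `weight b i`. -/
noncomputable def mixture (b : ℕ → EuclideanSpace ℝ (Fin n) → ℝ)
    (g : ℕ → EuclideanSpace ℝ (Fin n) → ℝ) (z : EuclideanSpace ℝ (Fin n)) : ℝ :=
  ∑' i, weight b i z * g i z

/-- Bounds `ε i` so small that mixing functions `|g i| ≤ ε i` costs at most `η` in slope. -/
lemma exists_mixing_bounds (hb : ∀ i z, b i z ∈ Icc (0 : ℝ) 1)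
    (hK : ∀ i, ∃ K : ℝ, ∀ z z', |b i z - b i z'| ≤ K * ‖z - z'‖) {η : ℝ} (hη : 0 < η)
    {δ : ℕ → ℝ} (hδ : ∀ i, 0 < δ i) :
    ∃ ε : ℕ → ℝ, (∀ i, 0 < ε i ∧ ε i ≤ δ i ∧ ε i ≤ 1) ∧
      ∀ i z z', |weight b i z - weight b i z'| * ε i ≤ η / 2 / 2 ^ i * ‖z - z'‖ := by
  choose K hKw using exists_lipschitz_weight hb hK
  have hpos : ∀ i, 0 < η / 2 / 2 ^ i / (|K i| + 1) := fun i => by positivity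
  refine ⟨fun i => min (min (δ i) 1) (η / 2 / 2 ^ i / (|K i| + 1)), fun i => ⟨?_, ?_, ?_⟩,
    fun i z z' => ?_⟩
  · exact lt_min (lt_min (hδ i) one_pos) (hpos i)
  · exact (min_le_left _ _).trans (min_le_left _ _)
  · exact (min_le_left _ _).trans (min_le_right _ _)
  · have h1 : |weight b i z - weight b i z'| ≤ (|K i| + 1) * ‖z - z'‖ :=
      (hKw i z z').trans (mul_le_mul_of_nonneg_right
        ((le_abs_self _).trans (by linarith)) (norm_nonneg _))
    calc _ ≤ ((|K i| + 1) * ‖z - z'‖) * (η / 2 / 2 ^ i / (|K i| + 1)) :=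
          mul_le_mul h1 (min_le_right _ _)
            (le_min (le_min (hδ i).le zero_le_one) (hpos i).le) (by positivity)
      _ = _ := by field_simp

variable {g : ℕ → EuclideanSpace ℝ (Fin n) → ℝ}

lemma summable_weight_mul (hb : ∀ i z, b i z ∈ Icc (0 : ℝ) 1) (hg : ∀ i z, |g i z| ≤ 1)
    (z : EuclideanSpace ℝ (Fin n)) : Summable fun i => weight b i z * g i z :=
  Summable.of_norm_bounded (summable_weight hb z) fun i => by
    rw [norm_mul, Real.norm_eq_abs, Real.norm_eq_abs, abs_of_nonneg (weight_nonneg hb i z)]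
    exact mul_le_of_le_one_right (weight_nonneg hb i z) (hg i z)

lemma abs_mixture_le (hb : ∀ i z, b i z ∈ Icc (0 : ℝ) 1) {z : EuclideanSpace ℝ (Fin n)} {C : ℝ}
    (hC : 0 ≤ C) (hg : ∀ i, b i z ≠ 0 → |g i z| ≤ C) : |mixture b g z| ≤ C := by
  have h1 := (summable_weight hb z).hasSum.mul_right C
  rw [mixture, ← Real.norm_eq_abs]
  refine (tsum_of_norm_bounded h1 fun i => ?_).trans
    (mul_le_of_le_one_left hC (tsum_weight_le hb z))
  rw [norm_mul, Real.norm_eq_abs, Real.norm_eq_abs, abs_of_nonneg (weight_nonneg hb i z)]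
  by_cases h : b i z = 0
  · simp [weight, h]
  · exact mul_le_mul_of_nonneg_left (hg i h) (weight_nonneg hb i z)

/-- The product rule splits each slope into a weighted average of slopes of the `g i` and an error
from the variation of the weights. By `hεη` the errors form a geometric series with sum `η`. -/
lemma mixture_lipschitz (hb : ∀ i z, b i z ∈ Icc (0 : ℝ) 1) {ε : ℕ → ℝ} {η L : ℝ}
    (hε : ∀ i, ε i ≤ 1)
    (hεη : ∀ i z z', |weight b i z - weight b i z'| * ε i ≤ η / 2 / 2 ^ i * ‖z - z'‖)
    (hg : ∀ i z, |g i z| ≤ ε i) (hL : 0 ≤ L)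
    (hgL : ∀ i z z', |g i z - g i z'| ≤ L * ‖z - z'‖) (z z' : EuclideanSpace ℝ (Fin n)) :
    |mixture b g z - mixture b g z'| ≤ (L + η) * ‖z - z'‖ := by
  have hg1 : ∀ i z, |g i z| ≤ 1 := fun i z => (hg i z).trans (hε i)
  rw [mixture, mixture, ← (summable_weight_mul hb hg1 z).tsum_sub (summable_weight_mul hb hg1 z'),
    ← Real.norm_eq_abs]
  have h1 := ((summable_weight hb z).hasSum.mul_right (L * ‖z - z'‖)).add
    ((hasSum_geometric_two' η).mul_right ‖z - z'‖)
  refine (tsum_of_norm_bounded h1 fun i => ?_).trans ?_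
  · rw [show weight b i z * g i z - weight b i z' * g i z' = weight b i z * (g i z - g i z')
      + (weight b i z - weight b i z') * g i z' by ring]
    refine (norm_add_le _ _).trans (add_le_add ?_ ?_)
    · rw [norm_mul, Real.norm_eq_abs, Real.norm_eq_abs, abs_of_nonneg (weight_nonneg hb i z)]
      exact mul_le_mul_of_nonneg_left (hgL i z z') (weight_nonneg hb i z)
    · rw [norm_mul, Real.norm_eq_abs, Real.norm_eq_abs]
      exact (mul_le_mul_of_nonneg_left (hg i z') (abs_nonneg _)).trans (hεη i z z')
  · rw [add_mul]
    exact add_le_add_left (mul_le_of_le_one_left (by positivity) (tsum_weight_le hb z)) _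

lemma mixture_eq_sum {m : ℕ} {z : EuclideanSpace ℝ (Fin n)} (hm : b m z = 1) :
    mixture b g z = ∑ i ∈ Finset.range (m + 1), weight b i z * g i z :=
  tsum_eq_sum fun i hi => by
    rw [weight_eq_zero_of_lt hm (by simpa [Nat.lt_succ_iff] using hi), zero_mul]

lemma continuous_weight (hbc : ∀ i, Continuous (b i)) (i : ℕ) : Continuous (weight b i) := by
  unfold weight
  exact (hbc i).mul (continuous_finsetProd _ fun j _ => continuous_const.sub (hbc j))

/-- The field of directions obtained by mixing the vectors `q i`. -/
noncomputable def mixedField (b : ℕ → EuclideanSpace ℝ (Fin n) → ℝ)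
    (q : ℕ → EuclideanSpace ℝ (Fin n)) (z : EuclideanSpace ℝ (Fin n)) : EuclideanSpace ℝ (Fin n) :=
  ∑' i, weight b i z • q i

lemma mixedField_eq_sum {m : ℕ} {z : EuclideanSpace ℝ (Fin n)} (hm : b m z = 1)
    (q : ℕ → EuclideanSpace ℝ (Fin n)) :
    mixedField b q z = ∑ i ∈ Finset.range (m + 1), weight b i z • q i :=
  tsum_eq_sum fun i hi => by
    rw [weight_eq_zero_of_lt hm (by simpa [Nat.lt_succ_iff] using hi), zero_smul]

lemma continuousAt_mixedField (hbc : ∀ i, Continuous (b i)) {m : ℕ}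
    {y : EuclideanSpace ℝ (Fin n)} (hm : ∀ᶠ z in 𝓝 y, b m z = 1)
    (q : ℕ → EuclideanSpace ℝ (Fin n)) : ContinuousAt (mixedField b q) y := by
  have h : ContinuousAt (fun z => ∑ i ∈ Finset.range (m + 1), weight b i z • q i) y :=
    (continuous_finsetSum _ fun i _ => (continuous_weight hbc i).smul
      continuous_const).continuousAt
  exact h.congr (hm.mono fun z hz => (mixedField_eq_sum hz q).symm)

/-- Besides the product-rule error `η`, there is an error `κ'` from freezing the continuous field at
`y`. The alternative in `hq` exempts the indices whose weight vanishes near `y`, for which nothing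
is known about `g i`. -/
lemma mixture_near (hb : ∀ i z, b i z ∈ Icc (0 : ℝ) 1) (hbc : ∀ i, Continuous (b i))
    {ε : ℕ → ℝ} {η κ κ' : ℝ} (hκ' : 0 < κ')
    (hεη : ∀ i z z', |weight b i z - weight b i z'| * ε i ≤ η / 2 / 2 ^ i * ‖z - z'‖)
    (hη : 0 < η)
    (hg : ∀ i z, |g i z| ≤ ε i) {y : EuclideanSpace ℝ (Fin n)} {m : ℕ}
    (hm : ∀ᶠ z in 𝓝 y, b m z = 1) {q : ℕ → EuclideanSpace ℝ (Fin n)}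
    (hq : ∀ i, ∀ᶠ p : EuclideanSpace ℝ (Fin n) × EuclideanSpace ℝ (Fin n) in 𝓝 (y, y),
      weight b i p.1 = 0 ∨
        |g i p.1 - g i p.2 - inner ℝ (q i) (p.1 - p.2)| ≤ κ * ‖p.1 - p.2‖) :
    ∀ᶠ p : EuclideanSpace ℝ (Fin n) × EuclideanSpace ℝ (Fin n) in 𝓝 (y, y),
      |mixture b g p.1 - mixture b g p.2 - inner ℝ (mixedField b q y) (p.1 - p.2)|
        ≤ (κ + η + κ') * ‖p.1 - p.2‖ := by
  have hu := (continuousAt_mixedField hbc hm q).eventually (Metric.closedBall_mem_nhds _ hκ')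
  have h1 := (Finset.range (m + 1)).eventually_all.2 fun i _ => hq i
  rw [nhds_prod_eq] at h1 ⊢
  filter_upwards [h1, hm.prod_inl (𝓝 y), hm.prod_inr (𝓝 y), hu.prod_inl (𝓝 y)] with p hp hm1 hm2 hup
  obtain ⟨z, z'⟩ := p
  simp only at hp hm1 hm2 hup ⊢
  have h2 : |mixture b g z - mixture b g z' - inner ℝ (mixedField b q z) (z - z')|
      ≤ (κ + η) * ‖z - z'‖ := by
    rw [mixture_eq_sum hm1, mixture_eq_sum hm2, mixedField_eq_sum hm1, sum_inner,
      ← Finset.sum_sub_distrib, ← Finset.sum_sub_distrib]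
    calc _ ≤ ∑ i ∈ Finset.range (m + 1), (weight b i z * (κ * ‖z - z'‖)
          + η / 2 / 2 ^ i * ‖z - z'‖) := by
          refine (Finset.abs_sum_le_sum_abs _ _).trans (Finset.sum_le_sum fun i hi => ?_)
          rw [real_inner_smul_left, show weight b i z * g i z - weight b i z' * g i z'
            - weight b i z * inner ℝ (q i) (z - z')
            = weight b i z * (g i z - g i z' - inner ℝ (q i) (z - z'))
              + (weight b i z - weight b i z') * g i z' by ring]
          refine (abs_add_le _ _).trans (add_le_add ?_ ?_)
          · rw [abs_mul, abs_of_nonneg (weight_nonneg hb i z)]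
            rcases hp i hi with h0 | h0
            · simp [h0]
            · exact mul_le_mul_of_nonneg_left h0 (weight_nonneg hb i z)
          · rw [abs_mul]
            exact (mul_le_mul_of_nonneg_left (hg i z') (abs_nonneg _)).trans (hεη i z z')
      _ ≤ _ := by
          rw [Finset.sum_add_distrib, ← Finset.sum_mul, ← Finset.sum_mul, sum_weight_eq_one hm1,
            one_mul, add_mul]
          gcongr
          exact sum_le_hasSum _ (fun i _ => by positivity) (hasSum_geometric_two' η)
  have h3 : |inner ℝ (mixedField b q z - mixedField b q y) (z - z')| ≤ κ' * ‖z - z'‖ := by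
    refine (abs_real_inner_le_norm _ _).trans (mul_le_mul_of_nonneg_right ?_ (norm_nonneg _))
    simpa [dist_eq_norm] using hup
  rw [inner_sub_left] at h3
  rw [abs_le] at h2 h3 ⊢
  constructor <;> linarith

end weight

/-! ### Functions attached to a set of width zero. -/

/-- A set of `(e,α)`-width zero, with the definition unfolded. -/
def NullWidth (e : EuclideanSpace ℝ (Fin n)) (α : ℝ) (Z : Set (EuclideanSpace ℝ (Fin n))) : Prop :=
  ∀ ε : ℝ, 0 < ε → ∃ H, IsOpen H ∧ Z ⊆ H ∧ openWidth e α H ≤ ENNReal.ofReal ε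

lemma nullWidth_of_width_eq_zero {e : EuclideanSpace ℝ (Fin n)} {α : ℝ}
    {Z : Set (EuclideanSpace ℝ (Fin n))} (he : e ≠ 0) (hα : α ≤ 1) (h : width e α Z = 0) :
    NullWidth e α Z := by
  intro ε hε
  rw [width, if_neg (by push Not; exact ⟨he, hα⟩)] at h
  have h1 : (⨅ (G : Set (EuclideanSpace ℝ (Fin n))) (_ : IsOpen G ∧ Z ⊆ G), openWidth e α G)
      < ENNReal.ofReal ε := by rw [h]; simpa using hε
  simp only [iInf_lt_iff] at h1
  obtain ⟨G, hG, hlt⟩ := h1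
  exact ⟨G, hG.1, hG.2, hlt.le⟩

lemma eventually_ball_prod {y : EuclideanSpace ℝ (Fin n)}
    {P : EuclideanSpace ℝ (Fin n) → EuclideanSpace ℝ (Fin n) → Prop} {r : ℝ} (hr : 0 < r)
    (h : ∀ z ∈ Metric.ball y r, ∀ z' ∈ Metric.ball y r, P z z') :
    ∀ᶠ p : EuclideanSpace ℝ (Fin n) × EuclideanSpace ℝ (Fin n) in 𝓝 (y, y), P p.1 p.2 := by
  filter_upwards [prod_mem_nhds (Metric.ball_mem_nhds y hr) (Metric.ball_mem_nhds y hr)] with p hp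
    using h _ hp.1 _ hp.2

lemma abs_clamp_sub_le (a c : ℝ) : |max 0 (min 1 a) - max 0 (min 1 c)| ≤ |a - c| := by
  have h1 := abs_max_sub_max_le_abs (min 1 a) (min 1 c) 0
  have h2 := abs_min_sub_min_le_max 1 a 1 c
  rw [max_comm 0, max_comm 0]
  refine h1.trans (h2.trans ?_)
  simp

lemma clamp_mem (a : ℝ) : max 0 (min 1 a) ∈ Icc (0 : ℝ) 1 :=
  ⟨le_max_left _ _, max_le zero_le_one (min_le_left _ _)⟩

lemma continuous_of_lipschitz {g : EuclideanSpace ℝ (Fin n) → ℝ} {K : ℝ}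
    (h : ∀ z z', |g z - g z'| ≤ K * ‖z - z'‖) : Continuous g :=
  (LipschitzWith.of_dist_le_mul (K := K.toNNReal) fun z z' => by
    rw [Real.dist_eq, dist_eq_norm]
    exact (h z z').trans (mul_le_mul_of_nonneg_right (Real.le_coe_toNNReal K)
      (norm_nonneg _))).continuous

/-- A set of width zero carries a Lipschitz function, as small as we wish, whose gradient on the set
is close to the given direction. -/
lemma NullWidth.exists_function {e v : EuclideanSpace ℝ (Fin n)} (he : e ≠ 0)
    (hve : v = ‖e‖⁻¹ • e) {β η ε : ℝ} (hβ : 0 < β) (hη : 0 < η) (hε : 0 < ε)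
    {Z : Set (EuclideanSpace ℝ (Fin n))} (hZ : NullWidth e (β / (1 + β)) Z)
    {D : EuclideanSpace ℝ (Fin n) → ℝ} (hD : ∀ z z', |D z - D z'| ≤ ‖z - z'‖)
    (hD0 : ∀ z, 0 ≤ D z) :
    ∃ g : EuclideanSpace ℝ (Fin n) → ℝ, (∀ z, |g z| ≤ ε * D z) ∧ (∀ z, |g z| ≤ ε) ∧
      (∀ z z', |g z - g z'| ≤ (1 + β + η) * ‖z - z'‖) ∧
      ∀ y ∈ Z, 0 < D y →
        ∀ᶠ p : EuclideanSpace ℝ (Fin n) × EuclideanSpace ℝ (Fin n) in 𝓝 (y, y),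
          |g p.1 - g p.2 - inner ℝ v (p.1 - p.2)| ≤ (β + η) * ‖p.1 - p.2‖ := by
  -- The cutoff `b j` vanishes unless `2 ^ j * D z > 1`, so functions bounded by `ε / 2 ^ j` are
  -- bounded by `ε * D` wherever they are used. Each `j` gets its own neighbourhood of `Z`, thin
  -- enough for that bound.
  set b : ℕ → EuclideanSpace ℝ (Fin n) → ℝ := fun j z => max 0 (min 1 (2 ^ j * D z - 1)) with hbdef
  have hb : ∀ i z, b i z ∈ Icc (0 : ℝ) 1 := fun i z => clamp_mem _
  have hbK : ∀ i z z', |b i z - b i z'| ≤ 2 ^ i * ‖z - z'‖ := fun i z z' => by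
    refine (abs_clamp_sub_le _ _).trans ?_
    rw [sub_sub_sub_cancel_right, ← mul_sub, abs_mul, abs_of_pos (by positivity)]
    exact mul_le_mul_of_nonneg_left (hD z z') (by positivity)
  have hbc : ∀ i, Continuous (b i) := fun i => continuous_of_lipschitz (hbK i)
  obtain ⟨δ, hδ, hδη⟩ := exists_mixing_bounds hb (fun i => ⟨_, hbK i⟩) (half_pos hη)
    (δ := fun i => ε / 2 ^ i) (fun i => by positivity)
  choose H hHo hZH hHw using fun i => hZ (δ i) (hδ i).1
  choose h hhb hhL hha using fun i => exists_lipschitz_width_function he hve hβ (hδ i).1.le (hHw i)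
  refine ⟨mixture b h, fun z => ?_, fun z => ?_, fun z z' => ?_, fun y hy hDy => ?_⟩
  · refine abs_mixture_le hb (mul_nonneg hε.le (hD0 z)) fun i hi => ?_
    refine (hhb i z).trans ((hδ i).2.1.trans ?_)
    have h1 : 1 ≤ 2 ^ i * D z := by
      by_contra! hlt
      exact hi (max_eq_left ((min_le_right _ _).trans (by linarith)))
    rw [div_le_iff₀ (by positivity)]
    nlinarith
  · refine abs_mixture_le hb hε.le fun i _ => ?_
    exact (hhb i z).trans ((hδ i).2.1.trans (div_le_self hε.le (one_le_pow₀ one_le_two)))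
  · refine (mixture_lipschitz hb (fun i => (hδ i).2.2) hδη hhb (by positivity) hhL z z').trans ?_
    gcongr
    linarith
  · have hDc : Continuous D := continuous_of_lipschitz (K := 1) (by simpa using hD)
    obtain ⟨m, hm⟩ := pow_unbounded_of_one_lt (2 / D y) (one_lt_two)
    rw [div_lt_iff₀ hDy] at hm
    have hm1 : ∀ᶠ z in 𝓝 y, b m z = 1 := by
      have : ∀ᶠ z in 𝓝 y, (2 : ℝ) < 2 ^ m * D z :=
        (continuous_const.mul hDc).continuousAt.eventually_const_lt hm
      filter_upwards [this] with z hz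
      simp only [hbdef]
      rw [min_eq_left (by linarith), max_eq_right zero_le_one]
    have hu : mixedField b (fun _ => v) y = v := by
      rw [mixedField_eq_sum hm1.self_of_nhds, ← Finset.sum_smul,
        sum_weight_eq_one hm1.self_of_nhds, one_smul]
    have := mixture_near hb hbc (half_pos hη) hδη (half_pos hη) hhb hm1 (q := fun _ => v) (κ := β)
      (fun i => by
        obtain ⟨r, hr, hball⟩ := Metric.isOpen_iff.1 (hHo i) y (hZH i hy)
        exact (eventually_ball_prod (by positivity : 0 < r / 3)
          (hha i y (r / 3) (by rwa [mul_div_cancel₀ _ three_ne_zero]))).mono fun p hp => Or.inr hp)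
    rw [hu] at this
    filter_upwards [this] with p hp
    linarith

/-! ### Fields of small gradients on a cone unrectifiable set. -/

/-- On the ball `B(y,r)` the function `g` is close to an affine function whose gradient is close to
the field `u`. -/
def IsAdapted (g : EuclideanSpace ℝ (Fin n) → ℝ)
    (u : EuclideanSpace ℝ (Fin n) → EuclideanSpace ℝ (Fin n)) (κ : ℝ)
    (y : EuclideanSpace ℝ (Fin n)) (r : ℝ) : Prop :=
  ∃ q : EuclideanSpace ℝ (Fin n), (∀ w ∈ Metric.ball y r, ‖u w - q‖ ≤ κ) ∧
    ∀ z ∈ Metric.ball y r, ∀ z' ∈ Metric.ball y r,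
      |g z - g z' - inner ℝ q (z - z')| ≤ κ * ‖z - z'‖

/-- The field `u` is, up to `κ`, the gradient near `E` of arbitrarily small Lipschitz functions
supported in arbitrarily small neighbourhoods of `E`. -/
def IsSmallGradient (E : Set (EuclideanSpace ℝ (Fin n)))
    (u : EuclideanSpace ℝ (Fin n) → EuclideanSpace ℝ (Fin n)) (κ : ℝ) : Prop :=
  ∀ D : EuclideanSpace ℝ (Fin n) → ℝ, (∀ z z', |D z - D z'| ≤ ‖z - z'‖) → (∀ z, 0 ≤ D z) →
    (∀ y ∈ E, 0 < D y) → ∀ ε : ℝ, 0 < ε →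
    ∃ g : EuclideanSpace ℝ (Fin n) → ℝ, (∀ z, |g z| ≤ ε * D z) ∧
      (∀ z z', |g z - g z'| ≤ 2 * ‖z - z'‖) ∧ ∀ y ∈ E, ∃ r > 0, IsAdapted g u κ y r

lemma isAdapted_of_eventually {g : EuclideanSpace ℝ (Fin n) → ℝ}
    {u : EuclideanSpace ℝ (Fin n) → EuclideanSpace ℝ (Fin n)} {κ : ℝ} (hκ : 0 < κ)
    {y : EuclideanSpace ℝ (Fin n)} (hu : ContinuousAt u y)
    (h : ∀ᶠ p : EuclideanSpace ℝ (Fin n) × EuclideanSpace ℝ (Fin n) in 𝓝 (y, y),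
      |g p.1 - g p.2 - inner ℝ (u y) (p.1 - p.2)| ≤ κ * ‖p.1 - p.2‖) :
    ∃ r > 0, IsAdapted g u κ y r := by
  have hu' := hu.eventually (Metric.closedBall_mem_nhds _ hκ)
  obtain ⟨r₁, hr₁, h1⟩ := Metric.eventually_nhds_iff_ball.1 hu'
  obtain ⟨r₂, hr₂, h2⟩ := Metric.eventually_nhds_iff_ball.1 h
  refine ⟨min r₁ r₂, lt_min hr₁ hr₂, u y, fun w hw => ?_, fun z hz z' hz' => ?_⟩
  · simpa [dist_eq_norm] using h1 w (Metric.ball_subset_ball (min_le_left _ _) hw)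
  · refine h2 (z, z') ?_
    rw [← ball_prod_same]
    exact ⟨Metric.ball_subset_ball (min_le_right _ _) hz,
      Metric.ball_subset_ball (min_le_right _ _) hz'⟩

/-- By the convention for `e = 0`, zero always belongs to `normals E x`, so differing from `{0}`
means having a nonzero element. -/
lemma exists_ne_zero_mem_normals {E : Set (EuclideanSpace ℝ (Fin n))} (hE : IsConeUnrectifiable E)
    {x : EuclideanSpace ℝ (Fin n)} (hx : x ∈ E) : ∃ e ∈ normals E x, e ≠ 0 := by
  by_contra! h
  refine hE x hx (subset_antisymm (fun e he => h e he) ?_)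
  rintro _ rfl ε -
  exact ⟨1, one_pos, by simp [width]⟩

/-- On a cone unrectifiable set there are `n` fields of small gradients, at least one of which is
not small at each given point. -/
lemma exists_smallGradient_fields {E : Set (EuclideanSpace ℝ (Fin n))} (hE : IsConeUnrectifiable E)
    (hne : E.Nonempty) {κ : ℝ} (hκ : 0 < κ) :
    ∃ u : Fin n → EuclideanSpace ℝ (Fin n) → EuclideanSpace ℝ (Fin n),
      (∀ c, IsSmallGradient E (u c) κ) ∧ ∀ x ∈ E, ∑ c, (u c x) c = 1 := by
  -- Four errors of size `β` must fit into `κ`, and `1 + 3 * β` must not exceed the Lipschitz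
  -- constant `2`.
  set β : ℝ := min κ 1 / 4 with hβdef
  have hm0 : 0 < min κ 1 := lt_min hκ one_pos
  have hβ : 0 < β := by positivity
  have hβκ : 4 * β ≤ κ := by rw [hβdef]; linarith [min_le_left κ 1]
  have hβ1 : 4 * β ≤ 1 := by rw [hβdef]; linarith [min_le_right κ 1]
  have hα0 : 0 < β / (1 + β) := by positivity
  have hα1 : β / (1 + β) ≤ 1 := (div_le_one (by positivity)).2 (by linarith)
  have hex : ∀ x : E, ∃ (e : EuclideanSpace ℝ (Fin n)) (r : ℝ), e ≠ 0 ∧ 0 < r ∧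
      NullWidth e (β / (1 + β)) (Metric.ball (x : EuclideanSpace ℝ (Fin n)) r ∩ E) := by
    intro x
    obtain ⟨e, he, he0⟩ := exists_ne_zero_mem_normals hE x.2
    obtain ⟨r, hr, hw⟩ := he _ hα0
    exact ⟨e, r, he0, hr, nullWidth_of_width_eq_zero he0 hα1 hw⟩
  choose e r he hr hnull using hex
  obtain ⟨t, htc, ht⟩ := TopologicalSpace.isOpen_iUnion_countable
    (fun x : E => Metric.ball (x : EuclideanSpace ℝ (Fin n)) (r x / 3))
    (fun x => Metric.isOpen_ball)
  have hcov : ∀ y ∈ E, ∃ x ∈ t, y ∈ Metric.ball (x : EuclideanSpace ℝ (Fin n)) (r x / 3) := by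
    intro y hy
    have : y ∈ ⋃ x : E, Metric.ball (x : EuclideanSpace ℝ (Fin n)) (r x / 3) :=
      mem_iUnion.2 ⟨⟨y, hy⟩, Metric.mem_ball_self (by have := hr ⟨y, hy⟩; positivity)⟩
    rw [← ht] at this
    simpa using this
  have htne : t.Nonempty := by
    obtain ⟨y, hy⟩ := hne
    obtain ⟨x, hx, -⟩ := hcov y hy
    exact ⟨x, hx⟩
  obtain ⟨s, rfl⟩ := htc.exists_eq_range htne
  set v : ℕ → EuclideanSpace ℝ (Fin n) := fun i => ‖e (s i)‖⁻¹ • e (s i) with hvdef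
  have hv : ∀ i, ‖v i‖ = 1 := fun i => by
    rw [hvdef, norm_smul, norm_inv, norm_norm, inv_mul_cancel₀ (norm_ne_zero_iff.2 (he _))]
  set b : ℕ → EuclideanSpace ℝ (Fin n) → ℝ :=
    fun i z => max 0 (min 1 (2 - 3 / r (s i) * dist z (s i))) with hbdef
  have hb : ∀ i z, b i z ∈ Icc (0 : ℝ) 1 := fun i z => clamp_mem _
  have hbK : ∀ i z z', |b i z - b i z'| ≤ 3 / r (s i) * ‖z - z'‖ := fun i z z' => by
    have := hr (s i)
    refine (abs_clamp_sub_le _ _).trans ?_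
    rw [sub_sub_sub_cancel_left, ← mul_sub, abs_mul, abs_of_pos (by positivity), ← dist_eq_norm,
      dist_comm z z']
    exact mul_le_mul_of_nonneg_left (abs_dist_sub_le _ _ _) (by positivity)
  have hbc : ∀ i, Continuous (b i) := fun i => continuous_of_lipschitz (hbK i)
  have hone : ∀ y ∈ E, ∃ m, ∀ᶠ z in 𝓝 y, b m z = 1 := by
    intro y hy
    obtain ⟨_, ⟨m, rfl⟩, hm⟩ := hcov y hy
    refine ⟨m, ?_⟩
    filter_upwards [Metric.isOpen_ball.mem_nhds hm] with z hz
    have h0 := hr (s m)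
    rw [Metric.mem_ball] at hz
    have h1 : 3 / r (s m) * dist z (s m) ≤ 1 := by
      rw [div_mul_eq_mul_div, div_le_one h0]; linarith
    simp only [hbdef]
    rw [min_eq_left (by linarith), max_eq_right zero_le_one]
  -- Row `c` of the averaged matrix `v i ⊗ v i`. The diagonal entries add up to the trace, which is
  -- one because the `v i` are unit vectors.
  refine ⟨fun c => mixedField b fun i => (v i) c • v i, fun c => ?_, fun x hx => ?_⟩
  · intro D hD hD0 hDE ε hε
    obtain ⟨δ, hδ, hδη⟩ := exists_mixing_bounds hb (fun i => ⟨_, hbK i⟩) hβ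
      (δ := fun _ => ε) (fun _ => hε)
    choose h hhD hhb hhL hha using fun i => (hnull (s i)).exists_function (he (s i)) rfl hβ hβ
      (hδ i).1 hD hD0
    have ha : ∀ i, |(v i) c| ≤ 1 := fun i => by
      have := PiLp.norm_apply_le (v i) c
      rwa [hv, Real.norm_eq_abs] at this
    have hmul : ∀ i (x C : ℝ), |x| ≤ C → |(v i) c * x| ≤ C := fun i x C hx => by
      rw [abs_mul]
      exact (mul_le_of_le_one_left (abs_nonneg _) (ha i)).trans hx
    refine ⟨mixture b fun i z => (v i) c * h i z, fun z => ?_, fun z z' => ?_, fun y hy => ?_⟩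
    · refine abs_mixture_le hb (mul_nonneg hε.le (hD0 z)) fun i _ => hmul _ _ _ ?_
      exact (hhD i z).trans (mul_le_mul_of_nonneg_right (hδ i).2.1 (hD0 z))
    · refine (mixture_lipschitz hb (fun i => (hδ i).2.2) hδη (fun i z => hmul _ _ _ (hhb i z))
        (L := 1 + β + β) (by positivity) (fun i z z' => ?_) z z').trans ?_
      · rw [← mul_sub]; exact hmul _ _ _ (hhL i z z')
      · gcongr; linarith
    · obtain ⟨m, hm⟩ := hone y hy
      refine isAdapted_of_eventually hκ (continuousAt_mixedField hbc hm _) ?_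
      have := mixture_near hb hbc hβ hδη hβ (g := fun i z => (v i) c * h i z)
        (fun i z => hmul _ _ _ (hhb i z)) hm
        (q := fun i => (v i) c • v i) (κ := β + β) (fun i => ?_)
      · filter_upwards [this] with p hp
        refine hp.trans ?_
        gcongr
        linarith
      -- The width is known to vanish only inside the ball of radius `r (s i)`; outside it the
      -- weight vanishes near `y`, since `b i` is zero beyond `2/3` of that radius.
      · rcases lt_or_ge (dist y (s i)) (r (s i)) with hlt | hge
        · filter_upwards [hha i y ⟨hlt, hy⟩ (hDE y hy)] with p hp
          right
          rw [real_inner_smul_left, ← mul_sub, ← mul_sub]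
          exact hmul _ _ _ hp
        · have h0 := hr (s i)
          have h1 : ∀ᶠ z in 𝓝 y, 2 / 3 * r (s i) < dist z (s i : EuclideanSpace ℝ (Fin n)) :=
            (continuous_id.dist continuous_const).continuousAt.eventually_const_lt
              (lt_of_lt_of_le (by linarith) hge)
          rw [nhds_prod_eq]
          filter_upwards [h1.prod_inl (𝓝 y)] with p hp
          left
          have h2 : 2 ≤ 3 / r (s i) * dist p.1 (s i) := by
            rw [div_mul_eq_mul_div, le_div_iff₀ h0]; linarith
          rw [weight]
          simp only [hbdef]
          rw [max_eq_left ((min_le_right _ _).trans (by linarith)), zero_mul]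
  · obtain ⟨m, hm⟩ := hone x hx
    simp only [mixedField_eq_sum hm.self_of_nhds, WithLp.ofLp_sum, Finset.sum_apply,
      WithLp.ofLp_smul, Pi.smul_apply, smul_eq_mul]
    rw [Finset.sum_comm]
    simp only [← Finset.mul_sum]
    rw [← sum_weight_eq_one hm.self_of_nhds]
    refine Finset.sum_congr rfl fun i _ => ?_
    have := EuclideanSpace.real_norm_sq_eq (v i)
    rw [hv] at this
    simp only [← sq, ← this]
    ring

lemma IsAdapted.mono {g : EuclideanSpace ℝ (Fin n) → ℝ}
    {u : EuclideanSpace ℝ (Fin n) → EuclideanSpace ℝ (Fin n)} {κ κ' : ℝ}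
    {y y' : EuclideanSpace ℝ (Fin n)} {r r' : ℝ} (h : IsAdapted g u κ y r) (hκ : κ ≤ κ')
    (hr : r' + dist y' y ≤ r) : IsAdapted g u κ' y' r' := by
  obtain ⟨q, hq, hg⟩ := h
  have hsub := Metric.ball_subset_ball' hr
  exact ⟨q, fun w hw => (hq w (hsub hw)).trans hκ, fun z hz z' hz' =>
    (hg z (hsub hz) z' (hsub hz')).trans (mul_le_mul_of_nonneg_right hκ (norm_nonneg _))⟩

lemma IsSmallGradient.mono {E : Set (EuclideanSpace ℝ (Fin n))}
    {u : EuclideanSpace ℝ (Fin n) → EuclideanSpace ℝ (Fin n)} {κ κ' : ℝ}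
    (h : IsSmallGradient E u κ) (hκ : κ ≤ κ') : IsSmallGradient E u κ' := by
  intro D hD hD0 hDE ε hε
  obtain ⟨g, h1, h2, h3⟩ := h D hD hD0 hDE ε hε
  refine ⟨g, h1, h2, fun y hy => ?_⟩
  obtain ⟨r, hr, h4⟩ := h3 y hy
  exact ⟨r, hr, h4.mono hκ (by simp)⟩

/-! ### Scales and the sequence of pairs. -/

/-- A nonnegative 1-Lipschitz function that is positive on `E`. -/
structure IsScale (E : Set (EuclideanSpace ℝ (Fin n))) (D : EuclideanSpace ℝ (Fin n) → ℝ) :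
    Prop where
  lipschitz : ∀ z z', |D z - D z'| ≤ ‖z - z'‖
  nonneg : ∀ z, 0 ≤ D z
  pos : ∀ y ∈ E, 0 < D y

lemma IsScale.min {E : Set (EuclideanSpace ℝ (Fin n))} {D D' : EuclideanSpace ℝ (Fin n) → ℝ}
    (h : IsScale E D) (h' : IsScale E D') : IsScale E fun z => min (D z) (D' z) where
  lipschitz z z' := (abs_min_sub_min_le_max _ _ _ _).trans (max_le (h.lipschitz z z')
    (h'.lipschitz z z'))
  nonneg z := le_min (h.nonneg z) (h'.nonneg z)
  pos y hy := lt_min (h.pos y hy) (h'.pos y hy)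

/-- The largest radius at most `δ` at which `g` is adapted to the field `u`. -/
noncomputable def adaptedRadius (g : EuclideanSpace ℝ (Fin n) → ℝ)
    (u : EuclideanSpace ℝ (Fin n) → EuclideanSpace ℝ (Fin n)) (κ δ : ℝ)
    (y : EuclideanSpace ℝ (Fin n)) : ℝ :=
  sSup {r | r ≤ δ ∧ IsAdapted g u κ y r}

section adaptedRadius

variable {g : EuclideanSpace ℝ (Fin n) → ℝ}
  {u : EuclideanSpace ℝ (Fin n) → EuclideanSpace ℝ (Fin n)} {κ δ : ℝ}

lemma bddAbove_adapted (y : EuclideanSpace ℝ (Fin n)) :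
    BddAbove {r | r ≤ δ ∧ IsAdapted g u κ y r} := ⟨δ, fun _ hr => hr.1⟩

lemma isAdapted_of_nonpos (y : EuclideanSpace ℝ (Fin n)) {r : ℝ} (hr : r ≤ 0) :
    IsAdapted g u κ y r :=
  ⟨0, by simp [Metric.ball_eq_empty.2 hr], by simp [Metric.ball_eq_empty.2 hr]⟩

lemma zero_mem_adapted (hδ : 0 ≤ δ) (y : EuclideanSpace ℝ (Fin n)) :
    (0 : ℝ) ∈ {r | r ≤ δ ∧ IsAdapted g u κ y r} := ⟨hδ, isAdapted_of_nonpos y le_rfl⟩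

lemma adaptedRadius_le (hδ : 0 ≤ δ) (y : EuclideanSpace ℝ (Fin n)) :
    adaptedRadius g u κ δ y ≤ δ :=
  csSup_le ⟨0, zero_mem_adapted hδ y⟩ fun _ hr => hr.1

/-- In `IsAdapted` the vector `q` belongs to the ball and not to its centre, so adaptedness passes
to smaller balls with other centres. This makes the radius 1-Lipschitz; nonpositive radii are
adapted vacuously. -/
lemma isScale_adaptedRadius {E : Set (EuclideanSpace ℝ (Fin n))} (hδ : 0 < δ)
    (h : ∀ y ∈ E, ∃ r > 0, IsAdapted g u κ y r) : IsScale E (adaptedRadius g u κ δ) where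
  lipschitz := by
    have key : ∀ z z', adaptedRadius g u κ δ z - adaptedRadius g u κ δ z' ≤ ‖z - z'‖ := by
      intro z z'
      rw [sub_le_iff_le_add]
      refine csSup_le ⟨0, zero_mem_adapted hδ.le z⟩ fun r hr => ?_
      rw [← sub_le_iff_le_add']
      refine le_csSup (bddAbove_adapted z') ⟨by linarith [hr.1, norm_nonneg (z - z')], ?_⟩
      exact hr.2.mono le_rfl (by rw [dist_comm, dist_eq_norm]; linarith)
    exact fun z z' => abs_sub_le_iff.2 ⟨key z z', by rw [norm_sub_rev]; exact key z' z⟩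
  nonneg z := le_csSup (bddAbove_adapted z) (zero_mem_adapted hδ.le z)
  pos y hy := by
    obtain ⟨r, hr, ha⟩ := h y hy
    exact lt_of_lt_of_le (lt_min hr hδ) (le_csSup (bddAbove_adapted y)
      ⟨min_le_right _ _, ha.mono le_rfl (by simp)⟩)

lemma abs_sub_inner_le_of_lt_adaptedRadius (hδ : 0 ≤ δ) {y z : EuclideanSpace ℝ (Fin n)}
    (hz : ‖z - y‖ < adaptedRadius g u κ δ y) :
    |g z - g y - inner ℝ (u y) (z - y)| ≤ 2 * κ * ‖z - y‖ := by
  obtain ⟨r, ⟨-, q, hq, hg⟩, hr⟩ := exists_lt_of_lt_csSup ⟨0, zero_mem_adapted hδ y⟩ hz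
  have hyr : y ∈ Metric.ball y r := Metric.mem_ball_self ((norm_nonneg _).trans_lt hr)
  have h1 := hg z (by rwa [Metric.mem_ball, dist_eq_norm]) y hyr
  have h2 := (abs_real_inner_le_norm (u y - q) (z - y)).trans
    (mul_le_mul_of_nonneg_right (hq y hyr) (norm_nonneg _))
  rw [inner_sub_left] at h2
  rw [abs_le] at h1 h2 ⊢
  constructor <;> linarith

end adaptedRadius

lemma IsSmallGradient.exists_step {E : Set (EuclideanSpace ℝ (Fin n))}
    {u : EuclideanSpace ℝ (Fin n) → EuclideanSpace ℝ (Fin n)} {κ : ℝ}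
    (hu : IsSmallGradient E u κ) {D : EuclideanSpace ℝ (Fin n) → ℝ} (hD : IsScale E D) {ε δ : ℝ}
    (hε : 0 < ε) (hδ : 0 < δ) :
    ∃ (g D' : EuclideanSpace ℝ (Fin n) → ℝ), IsScale E D' ∧ (∀ z, D' z ≤ D z) ∧ (∀ z, D' z ≤ δ) ∧
      (∀ z, |g z| ≤ ε * D z) ∧ (∀ z z', |g z - g z'| ≤ 2 * ‖z - z'‖) ∧
      ∀ y z, ‖z - y‖ < D' y → |g z - g y - inner ℝ (u y) (z - y)| ≤ 2 * κ * ‖z - y‖ := by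
  obtain ⟨g, h1, h2, h3⟩ := hu D hD.lipschitz hD.nonneg hD.pos ε hε
  exact ⟨g, fun z => min (D z) (adaptedRadius g u κ δ z), hD.min (isScale_adaptedRadius hδ h3),
    fun z => min_le_left _ _, fun z => (min_le_right _ _).trans (adaptedRadius_le hδ.le z), h1, h2,
    fun y z hz => abs_sub_inner_le_of_lt_adaptedRadius hδ.le (hz.trans_le (min_le_right _ _))⟩

/-- A sequence of pairs of functions with almost the same gradient near `E`, on smaller and smaller
scales. -/
structure PairSequence (E : Set (EuclideanSpace ℝ (Fin n)))
    (u : ℕ → EuclideanSpace ℝ (Fin n) → EuclideanSpace ℝ (Fin n)) (κ : ℕ → ℝ) where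
  /-- the scale before the pair -/
  D : ℕ → EuclideanSpace ℝ (Fin n) → ℝ
  /-- the scale between the two functions of the pair -/
  M : ℕ → EuclideanSpace ℝ (Fin n) → ℝ
  /-- the first function -/
  g : ℕ → EuclideanSpace ℝ (Fin n) → ℝ
  /-- the second function -/
  h : ℕ → EuclideanSpace ℝ (Fin n) → ℝ
  isScale_D : ∀ s, IsScale E (D s)
  isScale_M : ∀ s, IsScale E (M s)
  M_le : ∀ s z, M s z ≤ D s z
  D_succ_le : ∀ s z, D (s + 1) z ≤ M s z
  M_le_inv : ∀ s z, M s z ≤ 1 / ((s : ℝ) + 1)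
  abs_g_le : ∀ s z, |g s z| ≤ κ s * D s z
  abs_h_le : ∀ s z, |h s z| ≤ κ s * M s z
  g_lipschitz : ∀ s z z', |g s z - g s z'| ≤ 2 * ‖z - z'‖
  h_lipschitz : ∀ s z z', |h s z - h s z'| ≤ 2 * ‖z - z'‖
  g_near : ∀ s y z, ‖z - y‖ < M s y →
    |g s z - g s y - inner ℝ (u s y) (z - y)| ≤ 2 * κ s * ‖z - y‖
  h_near : ∀ s y z, ‖z - y‖ < D (s + 1) y →
    |h s z - h s y - inner ℝ (u s y) (z - y)| ≤ 2 * κ s * ‖z - y‖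

lemma exists_pairSequence {E : Set (EuclideanSpace ℝ (Fin n))}
    {u : ℕ → EuclideanSpace ℝ (Fin n) → EuclideanSpace ℝ (Fin n)} {κ : ℕ → ℝ}
    (hκ : ∀ s, 0 < κ s) (hu : ∀ s, IsSmallGradient E (u s) (κ s)) :
    Nonempty (PairSequence E u κ) := by
  have hδ : ∀ s : ℕ, 0 < 1 / ((s : ℝ) + 1) := fun s => by positivity
  choose g M hM hMD hMδ hgD hgL hgM using fun (s : ℕ)
    (D : {D : EuclideanSpace ℝ (Fin n) → ℝ // IsScale E D}) =>
      (hu s).exists_step D.2 (hκ s) (hδ s)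
  let M' : ℕ → {D : EuclideanSpace ℝ (Fin n) → ℝ // IsScale E D} →
    {D : EuclideanSpace ℝ (Fin n) → ℝ // IsScale E D} := fun s D => ⟨M s D, hM s D⟩
  let D₀ : {D : EuclideanSpace ℝ (Fin n) → ℝ // IsScale E D} :=
    ⟨fun _ => 1, by simp, by simp, by simp⟩
  -- Each index shrinks the scale twice: once after `g s` and once after `h s`.
  let D : ℕ → {D : EuclideanSpace ℝ (Fin n) → ℝ // IsScale E D} :=
    fun s => Nat.rec D₀ (fun s D => M' s (M' s D)) s
  exact ⟨{
    D := fun s => (D s).1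
    M := fun s => M s (D s)
    g := fun s => g s (D s)
    h := fun s => g s (M' s (D s))
    isScale_D := fun s => (D s).2
    isScale_M := fun s => hM s (D s)
    M_le := fun s => hMD s (D s)
    D_succ_le := fun s => hMD s (M' s (D s))
    M_le_inv := fun s => hMδ s (D s)
    abs_g_le := fun s => hgD s (D s)
    abs_h_le := fun s => hgD s (M' s (D s))
    g_lipschitz := fun s => hgL s (D s)
    h_lipschitz := fun s => hgL s (M' s (D s))
    g_near := fun s => hgM s (D s)
    h_near := fun s => hgM s (M' s (D s)) }⟩

/-! ### The sum of the differences is Lipschitz. -/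

/-- A function whose slopes at each point are at most `L` is Lipschitz. -/
lemma abs_sub_le_of_eventually {F : EuclideanSpace ℝ (Fin n) → ℝ} {L : ℝ}
    (h : ∀ y, ∀ᶠ z in 𝓝 y, |F z - F y| ≤ L * ‖z - y‖) (y z : EuclideanSpace ℝ (Fin n)) :
    |F z - F y| ≤ L * ‖z - y‖ := by
  have hc : Continuous F := by
    refine continuous_iff_continuousAt.2 fun y => ?_
    rw [ContinuousAt, tendsto_iff_dist_tendsto_zero]
    have h0 : Tendsto (fun z => L * ‖z - y‖) (𝓝 y) (𝓝 0) := by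
      have : Continuous fun z : EuclideanSpace ℝ (Fin n) => L * ‖z - y‖ := by fun_prop
      simpa using this.tendsto y
    exact squeeze_zero' (Eventually.of_forall fun _ => dist_nonneg) (by simpa [Real.dist_eq] using h y) h0
  set ℓ : ℝ → EuclideanSpace ℝ (Fin n) := fun t => y + t • (z - y) with hℓ
  have hℓc : Continuous ℓ := by fun_prop
  have hℓs : ∀ s t, ‖ℓ s - ℓ t‖ = |s - t| * ‖z - y‖ := fun s t => by
    rw [← Real.norm_eq_abs, ← norm_smul]; congr 1; simp only [hℓ]; module
  -- Continuous induction along the segment from `y` to `z`.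
  have key : Icc (0 : ℝ) 1 ⊆ {t | |F (ℓ t) - F (ℓ 0)| ≤ L * (t * ‖z - y‖)} := by
    refine IsClosed.Icc_subset_of_forall_exists_gt ?_ (by simp) ?_
    · refine IsClosed.inter (isClosed_le ?_ ?_) isClosed_Icc <;> fun_prop
    · rintro t ⟨ht, ht01⟩ t' htt'
      have h1 : ∀ᶠ s in 𝓝[>] t, |F (ℓ s) - F (ℓ t)| ≤ L * ‖ℓ s - ℓ t‖ :=
        nhdsWithin_le_nhds (hℓc.continuousAt.eventually (h (ℓ t)))
      obtain ⟨s, hs, hst⟩ := (h1.and (Ioc_mem_nhdsGT htt')).exists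
      refine ⟨s, ?_, hst⟩
      rw [hℓs, abs_of_pos (sub_pos.2 hst.1)] at hs
      have h2 : |F (ℓ t) - F (ℓ 0)| ≤ L * (t * ‖z - y‖) := ht
      show |F (ℓ s) - F (ℓ 0)| ≤ L * (s * ‖z - y‖)
      calc _ ≤ |F (ℓ s) - F (ℓ t)| + |F (ℓ t) - F (ℓ 0)| := abs_sub_le _ _ _
        _ ≤ _ := add_le_add hs h2
        _ = _ := by ring
  have := key (right_mem_Icc.2 zero_le_one)
  simpa [hℓ] using this

namespace PairSequence

variable {E : Set (EuclideanSpace ℝ (Fin n))}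
  {u : ℕ → EuclideanSpace ℝ (Fin n) → EuclideanSpace ℝ (Fin n)} {κ : ℕ → ℝ}
  (P : PairSequence E u κ)

/-- The difference of the two functions of a pair. -/
def diff (s : ℕ) (z : EuclideanSpace ℝ (Fin n)) : ℝ := P.g s z - P.h s z

/-- The sum of the first `S` differences. -/
def partialSum (S : ℕ) (z : EuclideanSpace ℝ (Fin n)) : ℝ := ∑ s ∈ Finset.range S, P.diff s z

/-- The sum of all differences. -/
noncomputable def limit (z : EuclideanSpace ℝ (Fin n)) : ℝ := ∑' s, P.diff s z

lemma D_antitone : Antitone P.D :=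
  antitone_nat_of_succ_le fun s z => (P.D_succ_le s z).trans (P.M_le s z)

lemma abs_diff_le (hκ : ∀ s, 0 < κ s) (s : ℕ) (z : EuclideanSpace ℝ (Fin n)) :
    |P.diff s z| ≤ 2 * κ s * P.D s z := by
  have h1 := P.abs_g_le s z
  have h2 := (P.abs_h_le s z).trans (mul_le_mul_of_nonneg_left (P.M_le s z) (hκ s).le)
  rw [diff]
  rw [abs_le] at h1 h2 ⊢
  constructor <;> linarith

lemma abs_diff_sub_le (s : ℕ) (z z' : EuclideanSpace ℝ (Fin n)) :
    |P.diff s z - P.diff s z'| ≤ 4 * ‖z - z'‖ := by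
  have h1 := P.g_lipschitz s z z'
  have h2 := P.h_lipschitz s z z'
  rw [diff, diff]
  rw [abs_le] at h1 h2 ⊢
  constructor <;> linarith

lemma diff_near {s : ℕ} {y z : EuclideanSpace ℝ (Fin n)} (hz : ‖z - y‖ < P.D (s + 1) y) :
    |P.diff s z - P.diff s y| ≤ 4 * κ s * ‖z - y‖ := by
  have h1 := P.g_near s y z (hz.trans_le (P.D_succ_le s y))
  have h2 := P.h_near s y z hz
  rw [diff, diff]
  rw [abs_le] at h1 h2 ⊢
  constructor <;> linarith

lemma partialSum_near {S : ℕ} {y z : EuclideanSpace ℝ (Fin n)} (hz : ‖z - y‖ < P.D S y) :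
    |P.partialSum S z - P.partialSum S y| ≤ (∑ s ∈ Finset.range S, 4 * κ s) * ‖z - y‖ := by
  rw [partialSum, partialSum, ← Finset.sum_sub_distrib, Finset.sum_mul]
  refine (Finset.abs_sum_le_sum_abs _ _).trans (Finset.sum_le_sum fun s hs => ?_)
  exact P.diff_near (hz.trans_le (P.D_antitone (Finset.mem_range.1 hs) y))

/-- Where `D S y > 0`, all earlier differences are nearly flat near `y` and only the last
contributes its full slope `4`. Where `D S y = 0`, the last difference is bounded by `2 * κ S * D S
z ≤ 2 * κ S * ‖z - y‖`, and induction handles the rest. -/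
lemma eventually_partialSum (hκ : ∀ s, 0 < κ s) (S : ℕ) (y : EuclideanSpace ℝ (Fin n)) :
    ∀ᶠ z in 𝓝 y, |P.partialSum S z - P.partialSum S y|
      ≤ (4 + ∑ s ∈ Finset.range S, 4 * κ s) * ‖z - y‖ := by
  have hball : ∀ S, 0 < P.D S y → ∀ᶠ z in 𝓝 y, ‖z - y‖ < P.D S y := fun S hS => by
    filter_upwards [Metric.ball_mem_nhds y hS] with z hz
    rwa [Metric.mem_ball, dist_eq_norm] at hz
  induction S with
  | zero => exact Eventually.of_forall fun z => by simp [partialSum]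
  | succ S ih =>
    have hstep : ∀ z, P.partialSum (S + 1) z - P.partialSum (S + 1) y
        = (P.partialSum S z - P.partialSum S y) + (P.diff S z - P.diff S y) := fun z => by
      simp only [partialSum, Finset.sum_range_succ]; ring
    rcases (P.isScale_D S).nonneg y |>.eq_or_lt with h0 | hpos
    · filter_upwards [ih] with z hz
      rw [hstep, Finset.sum_range_succ]
      have h1 := P.abs_diff_le hκ S z
      have h2 := P.abs_diff_le hκ S y
      rw [← h0, mul_zero] at h2
      have h3 := (P.isScale_D S).lipschitz z y
      rw [← h0, sub_zero] at h3
      have h4 : 2 * κ S * P.D S z ≤ 2 * κ S * ‖z - y‖ :=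
        mul_le_mul_of_nonneg_left ((le_abs_self _).trans h3) (by linarith [hκ S])
      have h5 : 0 ≤ κ S * ‖z - y‖ := mul_nonneg (hκ S).le (norm_nonneg _)
      have h6 := abs_add_le (P.partialSum S z - P.partialSum S y) (P.diff S z - P.diff S y)
      have h7 := abs_sub (P.diff S z) (P.diff S y)
      linarith
    · filter_upwards [hball S hpos] with z hz
      rw [hstep, Finset.sum_range_succ]
      have h1 := P.partialSum_near hz
      have h2 := P.abs_diff_sub_le S z y
      have h5 : 0 ≤ κ S * ‖z - y‖ := mul_nonneg (hκ S).le (norm_nonneg _)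
      have h6 := abs_add_le (P.partialSum S z - P.partialSum S y) (P.diff S z - P.diff S y)
      linarith

section limit

variable {a : ℝ} (ha : 0 < a) (hκa : ∀ s, κ s = a / 2 / 2 ^ s)

include ha hκa

lemma sum_four_mul_le (S : ℕ) : ∑ s ∈ Finset.range S, 4 * κ s ≤ 4 * a := by
  rw [← Finset.mul_sum]
  simp only [hκa]
  exact mul_le_mul_of_nonneg_left
    (sum_le_hasSum _ (fun i _ => by positivity) (hasSum_geometric_two' a)) (by norm_num)

lemma abs_diff_add_le (S i : ℕ) (z : EuclideanSpace ℝ (Fin n)) :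
    |P.diff (i + S) z| ≤ a / 2 / 2 ^ i * (2 * P.D S z) := by
  have hκ : ∀ s, 0 < κ s := fun s => by rw [hκa]; positivity
  have h1 : κ (i + S) ≤ a / 2 / 2 ^ i := by
    rw [hκa]
    gcongr
    · norm_num
    · omega
  have h2 := (P.isScale_D (i + S)).nonneg z
  calc _ ≤ 2 * κ (i + S) * P.D (i + S) z := P.abs_diff_le hκ _ z
    _ = κ (i + S) * (2 * P.D (i + S) z) := by ring
    _ ≤ _ := mul_le_mul h1 (mul_le_mul_of_nonneg_left (P.D_antitone (Nat.le_add_left S i) z)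
        zero_le_two) (by positivity) (by positivity)

lemma summable_diff (z : EuclideanSpace ℝ (Fin n)) : Summable fun s => P.diff s z :=
  Summable.of_norm_bounded ((hasSum_geometric_two' a).summable.mul_right (2 * P.D 0 z)) fun i =>
    P.abs_diff_add_le ha hκa 0 i z

lemma abs_limit_sub_le (S : ℕ) (z : EuclideanSpace ℝ (Fin n)) :
    |P.limit z - P.partialSum S z| ≤ 2 * a * P.D S z := by
  rw [limit, ← (P.summable_diff ha hκa z).sum_add_tsum_nat_add S, partialSum, add_sub_cancel_left,
    ← Real.norm_eq_abs]
  refine (tsum_of_norm_bounded ((hasSum_geometric_two' a).mul_right (2 * P.D S z)) fun i =>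
    P.abs_diff_add_le ha hκa S i z).trans ?_
  linarith

lemma limit_lipschitz (y z : EuclideanSpace ℝ (Fin n)) :
    |P.limit z - P.limit y| ≤ (4 + 4 * a) * ‖z - y‖ := by
  have hκ : ∀ s, 0 < κ s := fun s => by rw [hκa]; positivity
  have ht : ∀ z, Tendsto (fun S => P.partialSum S z) atTop (𝓝 (P.limit z)) := fun z =>
    (P.summable_diff ha hκa z).hasSum.tendsto_sum_nat
  refine le_of_tendsto ((ht z).sub (ht y)).abs (Eventually.of_forall fun S => ?_)
  refine (abs_sub_le_of_eventually (P.eventually_partialSum hκ S) y z).trans ?_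
  gcongr
  exact sum_four_mul_le ha hκa S

end limit

end PairSequence

/-! ### Non-differentiability and the conclusion. -/

/-- If `f` is differentiable at `x` and close, at a small scale, to a function that is almost affine
with gradient `U`, then its derivative is close to `U`. -/
lemma abs_derivative_sub_inner_le {f F Δ : EuclideanSpace ℝ (Fin n) → ℝ}
    {A : EuclideanSpace ℝ (Fin n) →L[ℝ] ℝ} {U x : EuclideanSpace ℝ (Fin n)} {a C : ℝ}
    (hΔ : ∀ z z', |Δ z - Δ z'| ≤ ‖z - z'‖) (hx : 0 < Δ x) (ha : 0 < a)
    (hA : ∀ z, ‖z - x‖ < Δ x → |f z - f x - A (z - x)| ≤ a * ‖z - x‖)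
    (hF : ∀ z, ‖z - x‖ < Δ x → |F z - F x - inner ℝ U (z - x)| ≤ C * ‖z - x‖)
    (hfF : ∀ z, |f z - F z| ≤ 3 * a * Δ z) (w : EuclideanSpace ℝ (Fin n)) :
    |A w - inner ℝ U w| ≤ (C + 16 * a) * ‖w‖ := by
  rcases eq_or_ne w 0 with rfl | hw
  · simp
  have hw' : 0 < ‖w‖ := norm_pos_iff.2 hw
  set t : ℝ := Δ x / 2 / ‖w‖ with ht
  have ht0 : 0 < t := by positivity
  have htw : ‖t • w‖ = Δ x / 2 := by
    rw [norm_smul, Real.norm_of_nonneg ht0.le, ht, div_mul_cancel₀ _ hw'.ne']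
  have h1 := hA (x + t • w) (by rw [add_sub_cancel_left, htw]; linarith)
  have h2 := hF (x + t • w) (by rw [add_sub_cancel_left, htw]; linarith)
  have h3 := hfF (x + t • w)
  have h4 := hfF x
  have h5 := hΔ (x + t • w) x
  rw [add_sub_cancel_left, htw] at h1 h2 h5
  -- Comparing `f` with `F` at the two points costs `(9/2 + 3) * a * Δ x`, that is `15 * a` per unit
  -- of length `Δ x / 2`; differentiability adds one more `a`.
  have h6 : 3 * a * Δ (x + t • w) ≤ 3 * a * (3 / 2 * Δ x) :=
    mul_le_mul_of_nonneg_left (by linarith [(abs_le.1 h5).2]) (by positivity)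
  have h7 : |A (t • w) - inner ℝ U (t • w)| ≤ (C + 16 * a) * (Δ x / 2) := by
    rw [abs_le] at h1 h2 h3 h4 ⊢
    constructor <;> linarith
  rw [map_smul, inner_smul_right, smul_eq_mul, ← mul_sub, abs_mul, abs_of_pos ht0, ← htw,
    norm_smul, Real.norm_of_nonneg ht0.le] at h7
  refine le_of_mul_le_mul_left (h7.trans_eq ?_) ht0
  ring

lemma PairSequence.not_differentiableAt_limit {E : Set (EuclideanSpace ℝ (Fin n))}
    {u : ℕ → EuclideanSpace ℝ (Fin n) → EuclideanSpace ℝ (Fin n)} {κ : ℕ → ℝ}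
    (P : PairSequence E u κ) {a : ℝ} (ha : 0 < a) (hκa : ∀ s, κ s = a / 2 / 2 ^ s)
    {x : EuclideanSpace ℝ (Fin n)} (hx : x ∈ E) (hbig : ∀ N, ∃ s ≥ N, 100 * a ≤ ‖u s x‖) :
    ¬ DifferentiableAt ℝ P.limit x := by
  intro hd
  set A := fderiv ℝ P.limit x
  have hκ : ∀ s, 0 < κ s := fun s => by rw [hκa]; positivity
  have hκle : ∀ s, κ s ≤ a / 2 := fun s => by
    rw [hκa]; exact div_le_self (by positivity) (one_le_pow₀ one_le_two)
  have hA := (hasFDerivAt_iff_isLittleO.1 hd.hasFDerivAt).def ha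
  obtain ⟨r, hr, hA⟩ := Metric.eventually_nhds_iff.1 hA
  have hA' : ∀ z, ‖z - x‖ < r → |P.limit z - P.limit x - A (z - x)| ≤ a * ‖z - x‖ := fun z hz =>
    hA (by rwa [dist_eq_norm])
  obtain ⟨N, hN⟩ := exists_nat_one_div_lt hr
  have hM : ∀ s ≥ N, P.M s x < r := fun s hs =>
    (P.M_le_inv s x).trans_lt (lt_of_le_of_lt (by gcongr) hN)
  -- On the scale `D (N + 1) x` all completed pairs are flat and the tail is negligible, so the
  -- derivative is almost zero.
  have h1 : ∀ w, |A w - inner ℝ (0 : EuclideanSpace ℝ (Fin n)) w| ≤ (4 * a + 16 * a) * ‖w‖ := by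
    refine abs_derivative_sub_inner_le (P.isScale_D (N + 1)).lipschitz
      ((P.isScale_D (N + 1)).pos x hx) ha
      (fun z hz => hA' z (hz.trans_le ((P.D_succ_le N x).trans (hM N le_rfl).le)))
      (F := P.partialSum (N + 1)) (fun z hz => ?_) fun z => ?_
    · rw [inner_zero_left, sub_zero]
      exact (P.partialSum_near hz).trans
        (mul_le_mul_of_nonneg_right (PairSequence.sum_four_mul_le ha hκa _) (norm_nonneg _))
    · exact (P.abs_limit_sub_le ha hκa _ z).trans (mul_le_mul_of_nonneg_right (by linarith)
        ((P.isScale_D _).nonneg z))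
  obtain ⟨s, hs, hus⟩ := hbig N
  -- On the scale `M s x` the function `g s` is visible while `h s` and the tail are negligible, so
  -- the derivative is almost `u s x`. With the previous bound this forces `‖u s x‖ ≤ 41 * a`.
  have h2 : ∀ w, |A w - inner ℝ (u s x) w| ≤ (5 * a + 16 * a) * ‖w‖ := by
    refine abs_derivative_sub_inner_le (P.isScale_M s).lipschitz
      ((P.isScale_M s).pos x hx) ha (fun z hz => hA' z (hz.trans (hM s hs)))
      (F := fun z => P.partialSum s z + P.g s z) (fun z hz => ?_) fun z => ?_
    · have h3 := (P.partialSum_near (hz.trans_le (P.M_le s x))).trans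
        (mul_le_mul_of_nonneg_right (PairSequence.sum_four_mul_le ha hκa _) (norm_nonneg _))
      have h4 := (P.g_near s x z hz).trans (mul_le_mul_of_nonneg_right
        (by linarith [hκle s] : 2 * κ s ≤ a) (norm_nonneg _))
      rw [abs_le] at h3 h4 ⊢
      constructor <;> linarith
    · have h3 := (P.abs_limit_sub_le ha hκa (s + 1) z).trans (mul_le_mul_of_nonneg_left
        (P.D_succ_le s z) (by positivity))
      have h4 := (P.abs_h_le s z).trans (mul_le_mul_of_nonneg_right
        (by linarith [hκle s] : κ s ≤ a) ((P.isScale_M s).nonneg z))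
      have h5 : P.partialSum (s + 1) z = P.partialSum s z + (P.g s z - P.h s z) := by
        rw [PairSequence.partialSum, Finset.sum_range_succ]; rfl
      rw [h5] at h3
      rw [abs_le] at h3 h4 ⊢
      constructor <;> linarith
  have h3 := abs_le.1 (h1 (u s x))
  have h4 := abs_le.1 (h2 (u s x))
  rw [inner_zero_left] at h3
  rw [real_inner_self_eq_norm_sq] at h4
  nlinarith [norm_nonneg (u s x)]

end ConeUnrectifiable

open ConeUnrectifiable in
theorem mainTheorem2 (n : ℕ) (E : Set (EuclideanSpace ℝ (Fin n)))
    (hE : ConeUnrectifiable.IsConeUnrectifiable E) :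
    ∃ f : EuclideanSpace ℝ (Fin n) → ℝ,
      (∃ K : ℝ≥0, LipschitzWith K f) ∧ ∀ x ∈ E, ¬ DifferentiableAt ℝ f x := by
  rcases E.eq_empty_or_nonempty with rfl | hne
  · exact ⟨fun _ => 0, ⟨0, LipschitzWith.const 0⟩, by simp⟩
  -- For `n = 0` the trace identity would read `0 = 1`.
  have hn : 0 < n := by
    obtain ⟨u, -, hu⟩ := exists_smallGradient_fields hE hne one_pos
    obtain ⟨x, hx⟩ := hne
    rcases Nat.eq_zero_or_pos n with rfl | h
    · simpa using hu x hx
    · exact h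
  have hnR : (0 : ℝ) < n := Nat.cast_pos.2 hn
  set a : ℝ := 1 / n / 100 with hadef
  have ha : 0 < a := by positivity
  -- Block `k` serves the indices `n * k ≤ s < n * (k + 1)`, one for each of its `n` fields, so its
  -- tolerance must suit the largest of them.
  choose U hU hU1 using fun k : ℕ => exists_smallGradient_fields hE hne
    (by positivity : 0 < a / 2 / 2 ^ (n * (k + 1)))
  set u : ℕ → EuclideanSpace ℝ (Fin n) → EuclideanSpace ℝ (Fin n) :=
    fun s => U (s / n) ⟨s % n, Nat.mod_lt _ hn⟩ with hudef
  have hu : ∀ s, IsSmallGradient E (u s) (a / 2 / 2 ^ s) := fun s => by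
    refine (hU _ _).mono ?_
    gcongr
    · norm_num
    · exact (Nat.lt_mul_div_succ s hn).le
  obtain ⟨P⟩ := exists_pairSequence (fun s => by positivity) hu
  refine ⟨P.limit, ⟨(4 + 4 * a).toNNReal, LipschitzWith.of_dist_le_mul fun z y => ?_⟩,
    fun x hx => P.not_differentiableAt_limit ha (fun _ => rfl) hx fun N => ?_⟩
  · rw [Real.dist_eq, dist_eq_norm, Real.coe_toNNReal _ (by positivity)]
    exact P.limit_lipschitz ha (fun _ => rfl) y z
  · obtain ⟨c, -, hc⟩ : ∃ c ∈ Finset.univ, 1 / (n : ℝ) ≤ (U N c x) c := by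
      have : Nonempty (Fin n) := ⟨⟨0, hn⟩⟩
      refine Finset.exists_le_of_sum_le Finset.univ_nonempty ?_
      rw [hU1 N x hx]
      simp [hnR.ne']
    refine ⟨n * N + c, ?_, ?_⟩
    · nlinarith
    · have h1 : (n * N + c) / n = N := by
        rw [Nat.mul_add_div hn, Nat.div_eq_of_lt c.2, add_zero]
      have h2 : (n * N + c) % n = c := by rw [Nat.mul_add_mod, Nat.mod_eq_of_lt c.2]
      have h3 : u (n * N + c) x = U N c x := by
        simp only [hudef, h1, h2, Fin.eta]
      rw [h3, hadef]
      have h4 := (le_abs_self _).trans (PiLp.norm_apply_le (U N c x) c)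
      linarith
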